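/- Let $(\Omega,\mathcal F,\mathbb P)$ be a probability space, $T$ a finite horizon, $\mathcal N$ a finite set of units, and for every $j\in\mathcal N$ and $t\in\{1,\dots,T\}$ let $W_t^j:\Omega\to\mathbb W_t^j$ be a random variable in a measurable space. Assume that the global noises $W_t=(W_t^j)_{j\in\mathcal N}$, $t=1,\dots,T$, are independent. Fix a unit $i\in\mathcal N$ with the following data: nonempty measurable state spaces $\mathbb X_t^i$ ($0\le t\le T$), nonempty standard Borel control spaces $\mathbb U_t^i$ and measurable resource spaces $\mathcal R_t^i$ with measurable singletons ($0\le t\le T-1$), measurable dynamics $g_t^i:\mathbb X_t^i\times\mathbb U_t^i\times\mathbb W_{t+1}^i\to\mathbb X_{t+1}^i$, measurable coupling functions $\Theta_t^i:\mathbb X_t^i\times\mathbb U_t^i\to\mathcal R_t^i$, measurable instantaneous costs $L_t^i:\mathbb X_t^i\times\mathbb U_t^i\times\mathbb W_{t+1}^i\to(-\infty,+\infty]$ and a measurable final cost $K^i:\mathbb X_T^i\to(-\infty,+\infty]$. The $\sigma$-field $\mathcal G_t^i$ of the information of unit $i$ at time $t$ is either $\sigma(W_1,\dots,W_t)$ (centralized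 information structure) or $\sigma(W_1^i,\dots,W_t^i)$ (decentralized information structure); it is trivial for $t=0$. For a deterministic resource process $r^i=(r_0^i,\dots,r_{T-1}^i)\in\prod_{t}\mathcal R_t^i$, for $t\in\{0,\dots,T\}$ and $x\in\mathbb X_t^i$, the local resource value function is $$\overline V_t^i[r^i](x)=\inf_{X^i,U^i}\ \mathbb E\Big[\sum_{s=t}^{T-1}L_s^i(X_s^i,U_s^i,W_{s+1}^i)+K^i(X_T^i)\Big],$$ the infimum being over the processes $(X^i,U^i)$ such that $X_t^i=x$ and, for all $s\in\{t,\dots,T-1\}$, $X_{s+1}^i=g_s^i(X_s^i,U_s^i,W_{s+1}^i)$, $U_s^i$ is $\mathcal G_s^i$-measurable, and $\Theta_s^i(X_s^i,U_s^i)=r_s^i$ almost surely ($\inf\emptyset=+\infty$). Assume that the expectation is well defined for all such processes (the positive and the negative part do not both have infinite expectation) and that $\overline V_t^i[r^i](x)>-\infty$, for all $t$ and $x$. Expectations of extended-real random variables $Z$ are $\mathbb E[Z^+]-\mathbb E[Z^-]$, with the convention $\mathbb E[Z]=+\infty$ if $\mathbb E[Z^+]=+\infty$. Then, for the centralized as well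 as for the decentralized information structure, the local resource value functions satisfy, for all $x\in\mathbb X_T^i$, $$\overline V_T^i[r^i](x)=K^i(x),$$ and, for $t=T-1,\dots,0$ and all $x\in\mathbb X_t^i$, $$\overline V_t^i[r^i](x)=\inf_{u\in\mathbb U_t^i,\ \Theta_t^i(x,u)=r_t^i}\ \mathbb E\Big[L_t^i(x,u,W_{t+1}^i)+\overline V_{t+1}^i[r^i]\big(g_t^i(x,u,W_{t+1}^i)\big)\Big].$$ Moreover, for every $u$ with $\Theta_t^i(x,u)=r_t^i$, the random variable inside the last expectation is measurable up to a $\mathbb P$-null set and, if it is almost surely $<+\infty$, its expectation is well defined. -/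

import Mathlib

open MeasureTheory ProbabilityTheory

/-- The expectation of an extended-real random variable: `E[f⁺] - E[f⁻]`, with the usual convention
of minimization problems that it is `+∞` as soon as `E[f⁺] = +∞`. -/
noncomputable def extExpectation {Ω : Type*} [MeasurableSpace Ω] (P : Measure Ω)
    (f : Ω → EReal) : EReal :=
  open Classical in
  if ∫⁻ ω, (f ω).toENNReal ∂P = ⊤ then ⊤
  else ((∫⁻ ω, (f ω).toENNReal ∂P : ENNReal) : EReal)
    - ((∫⁻ ω, (-f ω).toENNReal ∂P : ENNReal) : EReal)

/-- The expectation of the extended-real function `f` is well defined: `f` is measurable (up to a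
null set) and `E[f⁺]`, `E[f⁻]` are not both `+∞`. -/
def HasExtExpectation {Ω : Type*} [MeasurableSpace Ω] (P : Measure Ω) (f : Ω → EReal) : Prop :=
  AEMeasurable f P ∧
    (∫⁻ ω, (f ω).toENNReal ∂P ≠ ⊤ ∨ ∫⁻ ω, (-f ω).toENNReal ∂P ≠ ⊤)

/-- The data of one unit with horizon `T`: dynamics `g`, coupling functions `Θ`, instantaneous costs
`L` and final cost `K`, all measurable, the costs with values in `(-∞, +∞]`.
Only the stages `t < T` (states: `t ≤ T`) matter. -/
structure LocalData (T : ℕ) (X U W R : ℕ → Type*)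
    [∀ t, MeasurableSpace (X t)] [∀ t, MeasurableSpace (U t)]
    [∀ t, MeasurableSpace (W t)] [∀ t, MeasurableSpace (R t)] where
  g : ∀ t, X t → U t → W (t + 1) → X (t + 1)
  Θ : ∀ t, X t → U t → R t
  L : ∀ t, X t → U t → W (t + 1) → EReal
  K : X T → EReal
  measurable_g : ∀ t < T, Measurable fun p : X t × U t × W (t + 1) => g t p.1 p.2.1 p.2.2
  measurable_Θ : ∀ t < T, Measurable fun p : X t × U t => Θ t p.1 p.2
  measurable_L : ∀ t < T, Measurable fun p : X t × U t × W (t + 1) => L t p.1 p.2.1 p.2.2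
  measurable_K : Measurable K
  L_ne_bot : ∀ t < T, ∀ x u w, L t x u w ≠ ⊥
  K_ne_bot : ∀ x, K x ≠ ⊥

/-- The two information structures. -/
inductive InfoStructure
  | centralized
  | decentralized

/-- The information available to unit `i` at time `t`: the σ-field generated by the noises of times
`1, …, t` of all units (centralized) or of unit `i` only (decentralized). -/
@[reducible] def infoField {ι Ω : Type*} {W : ι → ℕ → Type*} [∀ j t, MeasurableSpace (W j t)]
    (w : ∀ j t, Ω → W j t) (i : ι) : InfoStructure → ℕ → MeasurableSpace Ω
  | .centralized, t => ⨆ j : ι, ⨆ k ∈ Finset.Icc 1 t, MeasurableSpace.comap (w j k) inferInstance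
  | .decentralized, t => ⨆ k ∈ Finset.Icc 1 t, MeasurableSpace.comap (w i k) inferInstance

section LocalProblem

variable {T : ℕ} {ι Ω : Type*} [MeasurableSpace Ω] {W : ι → ℕ → Type*}
  [∀ j t, MeasurableSpace (W j t)] {i : ι} {X U R : ℕ → Type*}
  [∀ t, MeasurableSpace (X t)] [∀ t, MeasurableSpace (U t)] [∀ t, MeasurableSpace (R t)]

/-- The state process `ξ` and the control process `υ` of unit `i` are admissible for the local
resource problem that starts at time `t` in state `x`, with resource process `r`:
initial condition, dynamics, nonanticipativity, and the resource constraint almost surely. -/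
structure IsAdmissible (D : LocalData T X U (W i) R) (P : Measure Ω) (w : ∀ j t, Ω → W j t)
    (S : InfoStructure) (r : ∀ t, Ω → R t) (t : ℕ) (x : X t)
    (ξ : ∀ s, Ω → X s) (υ : ∀ s, Ω → U s) : Prop where
  init : ∀ ω, ξ t ω = x
  dynamics : ∀ s, t ≤ s → s < T → ∀ ω, ξ (s + 1) ω = D.g s (ξ s ω) (υ s ω) (w i (s + 1) ω)
  nonanticipative : ∀ s, t ≤ s → s < T → Measurable[infoField w i S s] (υ s)
  resource : ∀ s, t ≤ s → s < T → ∀ᵐ ω ∂P, D.Θ s (ξ s ω) (υ s ω) = r s ω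

/-- The random total cost of unit `i` from time `t` to the horizon. -/
noncomputable def costToGo (D : LocalData T X U (W i) R) (w : ∀ j t, Ω → W j t) (t : ℕ)
    (ξ : ∀ s, Ω → X s) (υ : ∀ s, Ω → U s) (ω : Ω) : EReal :=
  ∑ s ∈ Finset.Ico t T, D.L s (ξ s ω) (υ s ω) (w i (s + 1) ω) + D.K (ξ T ω)

/-- The local resource value function of unit `i` at time `t` for the resource process `r`. -/
noncomputable def resourceValue (D : LocalData T X U (W i) R) (P : Measure Ω)
    (w : ∀ j t, Ω → W j t) (S : InfoStructure) (r : ∀ t, Ω → R t) (t : ℕ) (x : X t) : EReal :=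
  ⨅ (ξ : ∀ s, Ω → X s) (υ : ∀ s, Ω → U s) (_ : IsAdmissible D P w S r t x ξ υ),
    extExpectation P (costToGo D w t ξ υ)

/-- The random one-stage cost at time `t` in state `x` under control `u`, completed with the cost
`V` of the next state. -/
noncomputable def stageCost (D : LocalData T X U (W i) R) (w : ∀ j t, Ω → W j t) (t : ℕ)
    (V : X (t + 1) → EReal) (x : X t) (u : U t) (ω : Ω) : EReal :=
  D.L t x u (w i (t + 1) ω) + V (D.g t x u (w i (t + 1) ω))

end LocalProblem

/-!
The Bellman equation has two halves.

*Lower bound.* Since the noises are independent over time, the noises up to any time may be frozen: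
by Fubini's theorem the expected cost of an admissible process is the average of the expected costs
of the processes obtained by freezing, and almost all of these are again admissible. Freezing up to
the initial time `t` makes the first control deterministic; freezing up to time `t + 1` then bounds
the cost from below by the first-stage cost completed with the value function
(`iInf_bellmanCost_le_optimalValue`).

*Upper bound.* Near-optimal policies for the states reached at time `t + 1` have to be chosen
measurably in the noise of that time, although the value functions need not be measurable and the
state and noise spaces are arbitrary measurable spaces. The property propagated backward in time is
`HasCodedPolicies`: the value function is the infimum of the expected costs of a jointly measurable
family of policies indexed by Baire space `ℕ → ℕ`. Three facts make the recursion work.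

* A jointly measurable function depends on the noise only through a measurable map to Cantor space
  (`exists_factor_natBool`), so that the theory of standard Borel spaces applies.
* Near-minimizers in the index can be selected measurably, up to a null set
  (`exists_measurable_ae_le_iInf_add`); this is the Jankov–von Neumann–Aumann theorem, which rests on
  the capacitability of analytic sets. The same theorem shows that the infimum is measurable up to
  a null set, whence the measurability asserted for the random cost in the recursion.
* A measurable selection is determined almost everywhere by a point of Baire space
  (`exists_universal_measurable`), so that first controls followed by selections form again a family
  indexed by Baire space (`consPolicy`).

The argument is carried out on the space of noise paths, where a policy is a sequence of functions of
the path. The processes of the theorem are transported there by the Doob–Dynkin lemma, for any noise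
process that generates the information and determines the noise of the unit. In the centralized
structure this is the global noise, in the decentralized structure it is the noise of the unit.
-/

/-! ### Measurable selection up to null sets -/

section Selection

open Set Filter Topology

/-- The sequences whose first `n` terms are bounded by those of `k`. -/
def boundedPrefix (k : ℕ → ℕ) (n : ℕ) : Set (ℕ → ℕ) := {z | ∀ i < n, z i ≤ k i}

/-- The sequences bounded by `k`; these sets form a cofinal family of compact sets in Baire space. -/
def boundedSeq (k : ℕ → ℕ) : Set (ℕ → ℕ) := Set.pi univ fun i => Iic (k i)

lemma isCompact_boundedSeq (k : ℕ → ℕ) : IsCompact (boundedSeq k) :=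
  isCompact_univ_pi fun i => (finite_Iic (k i)).isCompact

lemma exists_boundedPrefix_subset {k : ℕ → ℕ} {O : Set (ℕ → ℕ)} (hO : IsOpen O)
    (h : boundedSeq k ⊆ O) : ∃ n, boundedPrefix k n ⊆ O := by
  let V : ℕ → Set (ℕ → ℕ) := fun n => {z | PiNat.cylinder z n ⊆ O}
  have hV : ∀ n, IsOpen (V n) := fun n => by
    rw [isOpen_iff_mem_nhds]
    intro z hz
    refine Filter.mem_of_superset
      ((PiNat.isOpen_cylinder _ z n).mem_nhds (PiNat.self_mem_cylinder z n)) fun y hy => ?_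
    change PiNat.cylinder y n ⊆ O
    rw [PiNat.mem_cylinder_iff_eq.1 hy]
    exact hz
  have hmono : Monotone V := fun m n hmn z hz => (PiNat.cylinder_anti z hmn).trans hz
  have hcov : boundedSeq k ⊆ ⋃ n, V n := fun z hz => by
    obtain ⟨_, ⟨y, n, rfl⟩, hzy, hyO⟩ :=
      (PiNat.isTopologicalBasis_cylinders (fun _ : ℕ => ℕ)).exists_subset_of_mem_open (h hz) hO
    refine mem_iUnion.2 ⟨n, ?_⟩
    change PiNat.cylinder z n ⊆ O
    rw [PiNat.mem_cylinder_iff_eq.1 hzy]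
    exact hyO
  obtain ⟨n, hn⟩ := (isCompact_boundedSeq k).elim_directed_cover V hV hcov hmono.directed_le
  refine ⟨n, fun z hz => ?_⟩
  let y : ℕ → ℕ := fun i => if i < n then z i else 0
  have hy : y ∈ boundedSeq k := fun i _ => by
    by_cases hi : i < n
    · simpa [y, hi] using hz i hi
    · simp [y, hi]
  refine hn hy ?_
  rw [PiNat.mem_cylinder_iff]
  intro i hi
  simp [y, hi]

variable {Y : Type*} [TopologicalSpace Y] [PolishSpace Y] [MeasurableSpace Y] [BorelSpace Y]

/-- Analytic sets are capacitable: the range of a continuous map on Baire space is exhausted in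
measure by the images of compact sets. -/
lemma exists_le_measure_image_boundedSeq (μ : Measure Y) [IsFiniteMeasure μ] {f : (ℕ → ℕ) → Y}
    (hf : Continuous f) {c : ENNReal} (hc : c < μ (range f)) :
    ∃ k, c ≤ μ (f '' boundedSeq k) := by
  have step : ∀ (k : ℕ → ℕ) (n : ℕ), c < μ (f '' boundedPrefix k n) →
      ∃ m, c < μ (f '' boundedPrefix (Function.update k n m) (n + 1)) := by
    intro k n h
    have hU : f '' boundedPrefix k n
        = ⋃ m, f '' boundedPrefix (Function.update k n m) (n + 1) := by
      rw [← image_iUnion]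
      congr 1
      ext z
      simp only [boundedPrefix, mem_ofPred_eq, mem_iUnion]
      constructor
      · intro hz
        refine ⟨z n, fun i hi => ?_⟩
        rcases Nat.lt_succ_iff_lt_or_eq.1 hi with hi | rfl
        · rw [Function.update_of_ne hi.ne]; exact hz i hi
        · simp
      · rintro ⟨m, hm⟩ i hi
        have := hm i (hi.trans n.lt_succ_self)
        rwa [Function.update_of_ne hi.ne] at this
    have hmono : Monotone fun m => f '' boundedPrefix (Function.update k n m) (n + 1) := by
      intro a b hab
      refine image_mono fun z hz i hi => (hz i hi).trans ?_
      by_cases hin : i = n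
      · subst hin; simpa using hab
      · simp [Function.update_of_ne hin]
    rw [hU, hmono.measure_iUnion] at h
    exact lt_iSup_iff.1 h
  choose! m hm using step
  -- `K n` is the sequence after its first `n` terms have been chosen.
  let K : ℕ → ℕ → ℕ := fun n =>
    Nat.rec (fun _ => 0) (fun j kj => Function.update kj j (m kj j)) n
  have hK : ∀ n, c < μ (f '' boundedPrefix (K n) n) := by
    intro n
    induction n with
    | zero =>
      have : boundedPrefix (K 0) 0 = univ := by ext; simp [boundedPrefix]
      rwa [this, image_univ]
    | succ n ih => exact hm _ _ ih
  have hstab : ∀ i n, i < n → K n i = K (i + 1) i := by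
    intro i n hin
    induction n, (Nat.succ_le_of_lt hin) using Nat.le_induction with
    | base => rfl
    | succ n hn ih =>
      have : K (n + 1) = Function.update (K n) n (m (K n) n) := rfl
      rw [this, Function.update_of_ne (by omega), ih (by omega)]
  refine ⟨fun i => K (i + 1) i, le_of_not_gt fun hlt => ?_⟩
  obtain ⟨V, hV, hVo, hVc⟩ := Set.exists_isOpen_lt_of_lt _ _ hlt
  obtain ⟨n, hn⟩ := exists_boundedPrefix_subset (hVo.preimage hf) (image_subset_iff.1 hV)
  have h1 : f '' boundedPrefix (K n) n ⊆ V := by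
    refine image_subset_iff.2 fun z hz => hn fun i hi => ?_
    exact (hz i hi).trans_eq (hstab i n hi)
  exact ((hK n).trans_le (measure_mono h1)).not_gt hVc

/-- Baire space admits a continuous injection into the real line (through the Cantor set). -/
lemma exists_continuous_injective_real :
    ∃ θ : (ℕ → ℕ) → ℝ, Continuous θ ∧ Function.Injective θ := by
  let a : (ℕ → ℕ) → ℕ → Bool := fun z n => decide (z n.unpair.1 = n.unpair.2)
  have ha : Continuous a := by
    refine continuous_pi fun n => ?_
    exact (continuous_of_discreteTopology (f := fun j : ℕ => decide (j = n.unpair.2))).comp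
      (continuous_apply n.unpair.1)
  have ha' : Function.Injective a := by
    intro y z h
    funext i
    have := congrFun h (Nat.pair i (z i))
    simpa [a] using this
  refine ⟨fun z => (cantorSetHomeomorphNatToBool.symm (a z) : ℝ),
    continuous_subtype_val.comp (cantorSetHomeomorphNatToBool.symm.continuous.comp ha), ?_⟩
  exact Subtype.val_injective.comp (cantorSetHomeomorphNatToBool.symm.injective.comp ha')

/-- On the image of a compact set, a continuous map has a measurable right inverse: choose in every
fibre the point with the least value under a continuous injection into `ℝ`. -/
lemma exists_measurable_rightInverse_on_compact {f : (ℕ → ℕ) → Y} (hf : Continuous f)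
    {C : Set (ℕ → ℕ)} (hC : IsCompact C) :
    ∃ σ : Y → ℕ → ℕ, Measurable σ ∧ ∀ y ∈ f '' C, f (σ y) = y := by
  obtain ⟨θ, hθ, hθi⟩ := exists_continuous_injective_real
  let m : Y → ℝ := fun y => sInf (θ '' (C ∩ f ⁻¹' {y}))
  have hmin : ∀ y ∈ f '' C, ∃ z ∈ C, f z = y ∧ θ z = m y := by
    rintro _ ⟨z, hz, rfl⟩
    have hcomp : IsCompact (θ '' (C ∩ f ⁻¹' {f z})) :=
      (hC.inter_right (isClosed_singleton.preimage hf)).image hθ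
    obtain ⟨z', ⟨h1, h2⟩, h3⟩ := hcomp.sInf_mem ⟨θ z, z, ⟨hz, rfl⟩, rfl⟩
    exact ⟨z', h1, h2, h3⟩
  have hbdd : ∀ y, BddBelow (θ '' (C ∩ f ⁻¹' {y})) := fun y =>
    ((hC.inter_right (isClosed_singleton.preimage hf)).image hθ).bddBelow
  have hCm : MeasurableSet (f '' C) := (hC.image hf).isClosed.measurableSet
  have hm : Measurable m := by
    refine measurable_of_Iic fun q => ?_
    have : m ⁻¹' Iic q
        = f '' (C ∩ θ ⁻¹' Iic q) ∪ ((f '' C)ᶜ ∩ {_y | (0 : ℝ) ≤ q}) := by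
      ext y
      simp only [mem_preimage, mem_Iic, mem_union, mem_inter_iff, mem_compl_iff, mem_ofPred_eq]
      by_cases hy : y ∈ f '' C
      · constructor
        · intro h
          obtain ⟨z, hz, hzy, hzm⟩ := hmin y hy
          exact Or.inl ⟨z, ⟨hz, by simpa [hzm] using h⟩, hzy⟩
        · rintro (⟨z, ⟨hz, hzq⟩, rfl⟩ | h)
          · exact (csInf_le (hbdd _) ⟨z, ⟨hz, rfl⟩, rfl⟩).trans hzq
          · exact absurd hy h.1
      · have h0 : C ∩ f ⁻¹' {y} = ∅ := by
          rw [eq_empty_iff_forall_notMem]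
          rintro z ⟨hz, hzy⟩
          exact hy ⟨z, hz, hzy⟩
        have h1 : m y = 0 := by simp [m, h0]
        rw [h1]
        constructor
        · exact fun h => Or.inr ⟨hy, h⟩
        · rintro (⟨z, ⟨hz, _⟩, rfl⟩ | h)
          · exact absurd ⟨z, hz, rfl⟩ hy
          · exact h.2
    rw [this]
    exact ((hC.inter_right (isClosed_Iic.preimage hθ)).image hf).isClosed.measurableSet.union
      (hCm.compl.inter (MeasurableSet.const _))
  have hemb : MeasurableEmbedding θ := hθ.measurableEmbedding hθi
  refine ⟨fun y => hemb.invFun (m y), hemb.measurable_invFun.comp hm, fun y hy => ?_⟩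
  obtain ⟨z, -, hzy, hzm⟩ := hmin y hy
  change f (hemb.invFun (m y)) = y
  rw [← hzm, hemb.leftInverse_invFun z, hzy]

/-- A continuous map on Baire space has a measurable right inverse on almost all of its range: by
capacitability the range is, up to a null set, a countable union of images of compact sets. -/
lemma exists_measurable_ae_rightInverse (μ : Measure Y) [IsFiniteMeasure μ] {f : (ℕ → ℕ) → Y}
    (hf : Continuous f) :
    ∃ σ : Y → ℕ → ℕ, Measurable σ ∧ ∀ᵐ y ∂μ, y ∈ range f → f (σ y) = y := by
  classical
  by_cases h0 : μ (range f) = 0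
  · refine ⟨fun _ _ => 0, measurable_const, ?_⟩
    filter_upwards [measure_eq_zero_iff_ae_notMem.1 h0] with y hy hy'
    exact absurd hy' hy
  obtain ⟨u, -, hu, hulim⟩ := exists_seq_strictMono_tendsto' (pos_iff_ne_zero.2 h0)
  choose k hk using fun n => exists_le_measure_image_boundedSeq μ hf (hu n).2
  let A : ℕ → Set Y := fun n => f '' boundedSeq (k n)
  have hA : ∀ n, MeasurableSet (A n) := fun n =>
    ((isCompact_boundedSeq (k n)).image hf).isClosed.measurableSet
  have hAU : MeasurableSet (⋃ n, A n) := .iUnion hA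
  have hsub : (⋃ n, A n) ⊆ range f := iUnion_subset fun n => image_subset_range _ _
  have hnull : μ (range f \ ⋃ n, A n) = 0 := by
    have h1 : μ (range f) ≤ μ (⋃ n, A n) :=
      le_of_tendsto' hulim fun n => (hk n).trans (measure_mono (subset_iUnion A n))
    have h2 := measure_inter_add_sdiff (μ := μ) (range f) hAU
    rw [inter_eq_self_of_subset_right hsub] at h2
    have h3 : μ (⋃ n, A n) + μ (range f \ ⋃ n, A n) ≤ μ (⋃ n, A n) + 0 := by
      rw [h2, add_zero]; exact h1
    exact nonpos_iff_eq_zero.1 ((ENNReal.add_le_add_iff_left (measure_ne_top μ _)).1 h3)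
  choose σ hσm hσ using fun n =>
    exists_measurable_rightInverse_on_compact hf (isCompact_boundedSeq (k n))
  let p : ℕ → Y → Prop := fun n y => y ∈ A n ∨ y ∉ ⋃ n, A n
  have hp : ∀ y, ∃ n, p n y := fun y => by
    by_cases hy : y ∈ ⋃ n, A n
    · obtain ⟨n, hn⟩ := mem_iUnion.1 hy
      exact ⟨n, Or.inl hn⟩
    · exact ⟨0, Or.inr hy⟩
  refine ⟨fun y => σ (Nat.find (hp y)) y,
    Measurable.find (p := p) hσm (fun n => (hA n).union hAU.compl) hp, ?_⟩
  filter_upwards [measure_eq_zero_iff_ae_notMem.1 hnull] with y hy hyr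
  have hyA : y ∈ ⋃ n, A n := by
    by_contra h
    exact hy ⟨hyr, h⟩
  rcases Nat.find_spec (hp y) with h | h
  · exact hσ _ y h
  · exact absurd hyA h

/-- The **Jankov–von Neumann–Aumann selection theorem**, almost everywhere form: a measurable subset
of a product of standard Borel spaces is uniformized, over almost every point of its projection, by
a measurable map. -/
theorem exists_measurable_ae_selection {Y Z : Type*} [MeasurableSpace Y] [StandardBorelSpace Y]
    [MeasurableSpace Z] [StandardBorelSpace Z] [Nonempty Z] (μ : Measure Y) [IsFiniteMeasure μ]
    {B : Set (Y × Z)} (hB : MeasurableSet B) :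
    ∃ s : Y → Z, Measurable s ∧ ∀ᵐ y ∂μ, (∃ z, (y, z) ∈ B) → (y, s y) ∈ B := by
  let := upgradeStandardBorel Y
  let := upgradeStandardBorel Z
  have hBa : AnalyticSet B := hB.analyticSet
  rw [AnalyticSet] at hBa
  rcases hBa with rfl | ⟨f, hf, rfl⟩
  · exact ⟨fun _ => Classical.arbitrary Z, measurable_const, by simp⟩
  obtain ⟨σ, hσ, hσr⟩ := exists_measurable_ae_rightInverse μ (continuous_fst.comp hf)
  refine ⟨fun y => (f (σ y)).2, (measurable_snd.comp hf.measurable).comp hσ, ?_⟩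
  filter_upwards [hσr] with y hy
  rintro ⟨z, c, hc⟩
  have h1 : (f (σ y)).1 = y := hy ⟨c, by simp [hc]⟩
  exact ⟨σ y, by ext <;> simp [h1]⟩

/-- The infimum of a measurable function over a standard Borel variable is measurable up to a null
set. -/
theorem aemeasurable_iInf_standardBorel {Y Z : Type*} [MeasurableSpace Y] [StandardBorelSpace Y]
    [MeasurableSpace Z] [StandardBorelSpace Z] [Nonempty Z] (μ : Measure Y) [IsFiniteMeasure μ]
    {F : Y × Z → EReal} (hF : Measurable F) : AEMeasurable (fun y => ⨅ z, F (y, z)) μ := by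
  choose s hs hsel using fun q : ℚ => exists_measurable_ae_selection μ
    (measurableSet_lt hF (measurable_const (a := ((q : ℝ) : EReal))))
  refine ⟨fun y => ⨅ q : ℚ, F (y, s q y),
    .iInf fun q => hF.comp (measurable_id.prodMk (hs q)), ?_⟩
  filter_upwards [ae_all_iff.2 hsel] with y hy
  refine le_antisymm (le_iInf fun q => iInf_le _ _) (le_of_not_gt fun hlt => ?_)
  obtain ⟨q, hq1, hq2⟩ := EReal.lt_iff_exists_rat_btwn.1 hlt
  have h1 := hy q (iInf_lt_iff.1 hq1)
  exact (hq2.trans_le (iInf_le (fun q : ℚ => F (y, s q y)) q)).not_gt h1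

/-- Measurable choice of `ε`-minimizers, almost everywhere. -/
theorem exists_measurable_ae_le_iInf_add {Y Z : Type*} [MeasurableSpace Y] [StandardBorelSpace Y]
    [MeasurableSpace Z] [StandardBorelSpace Z] [Nonempty Z] (μ : Measure Y) [IsFiniteMeasure μ]
    {F : Y × Z → EReal} (hF : Measurable F) {ε : ℝ} (hε : 0 < ε) :
    ∃ s : Y → Z, Measurable s ∧
      ∀ᵐ y ∂μ, ⨅ z, F (y, z) ≠ ⊥ → F (y, s y) ≤ (⨅ z, F (y, z)) + ε := by
  obtain ⟨v, hv, hve⟩ := aemeasurable_iInf_standardBorel μ hF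
  obtain ⟨s, hs, hsel⟩ := exists_measurable_ae_selection μ
    (measurableSet_le hF ((hv.comp measurable_fst).add_const (ε : EReal)))
  refine ⟨s, hs, ?_⟩
  filter_upwards [hve, hsel] with y hy hys hbot
  simp only [Function.comp_apply, ← hy] at hys
  refine hys ?_
  by_cases htop : ⨅ z, F (y, z) = ⊤
  · exact ⟨Classical.arbitrary Z, by simp [htop]⟩
  · have hlt : ⨅ z, F (y, z) < (⨅ z, F (y, z)) + ε := by
      lift ⨅ z, F (y, z) to ℝ using ⟨htop, hbot⟩ with a
      exact_mod_cast lt_add_of_pos_right a hε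
    obtain ⟨z, hz⟩ := iInf_lt_iff.1 hlt
    exact ⟨z, hz.le⟩

end Selection

/-! ### A universal measurable function and factorization through Cantor space -/

section Coding

open Set Filter Topology

/-- For a fixed finite measure, a measurable set agrees almost everywhere with an upper limit of
members of any measure-dense family. -/
lemma exists_limsup_ae_eq {Y : Type*} [MeasurableSpace Y] (μ : Measure Y) [IsFiniteMeasure μ]
    {B : ℕ → Set Y} (hB : μ.MeasureDense (range B)) {s : Set Y} (hs : MeasurableSet s) :
    ∃ a : ℕ → ℕ, ∀ᵐ y ∂μ, (∃ᶠ n in atTop, y ∈ B (a n)) ↔ y ∈ s := by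
  have h1 : ∀ n : ℕ, ∃ k, μ (symmDiff s (B k)) < ENNReal.ofReal ((1 / 2) ^ n) := fun n => by
    obtain ⟨_, ⟨k, rfl⟩, hk⟩ := hB.approx s hs (measure_ne_top μ s) ((1 / 2) ^ n) (by positivity)
    exact ⟨k, hk⟩
  choose a ha using h1
  refine ⟨a, ?_⟩
  have hsum : ∑' n, μ (symmDiff s (B (a n))) ≠ ⊤ := by
    refine ne_top_of_le_ne_top ?_ (ENNReal.tsum_le_tsum fun n => (ha n).le)
    rw [← ENNReal.ofReal_tsum_of_nonneg (fun n => by positivity) summable_geometric_two]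
    exact ENNReal.ofReal_ne_top
  filter_upwards [ae_eventually_notMem hsum] with y hy
  have hev : ∀ᶠ n in atTop, (y ∈ B (a n) ↔ y ∈ s) := by
    filter_upwards [hy] with n hn
    rw [mem_symmDiff] at hn
    tauto
  rw [frequently_congr hev]
  exact frequently_const

/-- **A universal function modulo null sets.** There is a measurable function `e` of a code
`c : ℕ → ℕ` and a point `y` such that, whatever the finite measure on `Y`, every measurable map
`Y → Z` agrees almost everywhere with some section `e (c, ·)`. -/
theorem exists_universal_measurable (Y Z : Type*) [MeasurableSpace Y]
    [MeasurableSpace.CountablyGenerated Y] [MeasurableSpace Z] [StandardBorelSpace Z] [Nonempty Z] :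
    ∃ e : (ℕ → ℕ) × Y → Z, Measurable e ∧ ∀ (μ : Measure Y) [IsFiniteMeasure μ] (f : Y → Z),
      Measurable f → ∃ c, ∀ᵐ y ∂μ, e (c, y) = f y := by
  classical
  obtain ⟨B, hBr⟩ := (countable_generateSetAlgebra
    (MeasurableSpace.countable_countableGeneratingSet (α := Y))).exists_eq_range
      ⟨∅, isSetAlgebra_generateSetAlgebra.empty_mem⟩
  have hgen : (‹MeasurableSpace Y› : MeasurableSpace Y) = MeasurableSpace.generateFrom (range B) := by
    rw [← hBr, generateFrom_generateSetAlgebra_eq,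
      MeasurableSpace.generateFrom_countableGeneratingSet]
  have hdense : ∀ (μ : Measure Y) [IsFiniteMeasure μ], μ.MeasureDense (range B) := fun μ _ =>
    Measure.MeasureDense.of_generateFrom_isSetAlgebra_finite μ
      (hBr ▸ isSetAlgebra_generateSetAlgebra) hgen
  have hBm : ∀ k, MeasurableSet (B k) := fun k => by
    rw [hgen]; exact MeasurableSpace.measurableSet_generateFrom ⟨k, rfl⟩
  have hemb : MeasurableEmbedding (MeasurableSpace.mapNatBool Z) :=
    (MeasurableSpace.measurable_mapNatBool Z).measurableEmbedding
      (MeasurableSpace.injective_mapNatBool Z)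
  -- The code `c` lists, for every binary digit `n`, a sequence of indices `c (pair n k)`.
  let e₀ : (ℕ → ℕ) × Y → ℕ → Bool := fun p n =>
    decide (∃ᶠ k in atTop, p.2 ∈ B (p.1 (Nat.pair n k)))
  have he₀ : Measurable e₀ := by
    refine measurable_pi_iff.2 fun n => measurable_to_bool ?_
    have : (fun p => e₀ p n) ⁻¹' {true} =
        limsup (fun k => {p : (ℕ → ℕ) × Y | p.2 ∈ B (p.1 (Nat.pair n k))}) atTop := by
      ext p
      simp [e₀, mem_limsup_iff_frequently_mem]
    rw [this]
    refine MeasurableSet.measurableSet_limsup fun k => ?_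
    have : {p : (ℕ → ℕ) × Y | p.2 ∈ B (p.1 (Nat.pair n k))}
        = ⋃ j, {p : (ℕ → ℕ) × Y | p.1 (Nat.pair n k) = j} ∩ {p | p.2 ∈ B j} := by
      ext p; simp
    rw [this]
    refine .iUnion fun j => .inter ?_ (measurable_snd (hBm j))
    have hpi : Measurable fun p : (ℕ → ℕ) × Y => p.1 (Nat.pair n k) :=
      (measurable_pi_apply (Nat.pair n k)).comp measurable_fst
    exact hpi (measurableSet_singleton j)
  refine ⟨fun p => hemb.invFun (e₀ p), hemb.measurable_invFun.comp he₀, fun μ _ f hf => ?_⟩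
  have hdig : ∀ n, ∃ a : ℕ → ℕ, ∀ᵐ y ∂μ, (∃ᶠ k in atTop, y ∈ B (a k)) ↔
      y ∈ {y | MeasurableSpace.mapNatBool Z (f y) n = true} := fun n =>
    exists_limsup_ae_eq μ (hdense μ)
      (((measurable_pi_apply n).comp (hemb.measurable.comp hf)) (measurableSet_singleton true))
  choose a ha using hdig
  refine ⟨fun m => a m.unpair.1 m.unpair.2, ?_⟩
  filter_upwards [ae_all_iff.2 ha] with y hy
  have : e₀ (fun m => a m.unpair.1 m.unpair.2, y) = MeasurableSpace.mapNatBool Z (f y) := by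
    funext n
    rw [Bool.eq_iff_iff]
    simpa [e₀] using hy n
  change hemb.invFun (e₀ _) = _
  rw [this, hemb.leftInverse_invFun]

/-- A measurable set in a product depends on the second variable only through a measurable map to
Cantor space. -/
lemma exists_preimage_natBool {A E : Type*} [MeasurableSpace A] [MeasurableSpace E]
    {s : Set (A × E)} (hs : MeasurableSet s) :
    ∃ ψ : E → ℕ → Bool, Measurable ψ ∧
      MeasurableSet[(inferInstance : MeasurableSpace (A × (ℕ → Bool))).comap (Prod.map id ψ)] s := by
  classical
  rw [← generateFrom_prod] at hs
  induction s, hs using MeasurableSpace.generateFrom_induction with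
  | hC t ht _ =>
    obtain ⟨a, ha, b, hb, rfl⟩ := ht
    refine ⟨fun x _ => decide (x ∈ b), ?_, a ×ˢ {y | y 0 = true}, ?_, ?_⟩
    · refine measurable_pi_iff.2 fun _ => measurable_to_bool ?_
      convert! (hb : MeasurableSet b) using 1
      ext; simp
    · have h0 : Measurable fun y : ℕ → Bool => y 0 := measurable_pi_apply 0
      exact MeasurableSet.prod ha (h0 (measurableSet_singleton true))
    · ext; simp
  | empty => exact ⟨fun _ _ => true, measurable_const, @MeasurableSet.empty _ (_)⟩
  | compl t _ ih =>
    obtain ⟨ψ, hψ, h⟩ := ih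
    exact ⟨ψ, hψ, @MeasurableSet.compl _ _ (_) h⟩
  | iUnion t _ ih =>
    choose ψ hψ h using ih
    refine ⟨fun x n => ψ n.unpair.1 x n.unpair.2,
      measurable_pi_iff.2 fun n => (measurable_pi_apply _).comp (hψ _), ?_⟩
    refine @MeasurableSet.iUnion _ _ (_) _ _ fun i => ?_
    obtain ⟨u, hu, hut⟩ := h i
    let ρ : A × (ℕ → Bool) → A × (ℕ → Bool) := Prod.map id fun y n => y (Nat.pair i n)
    have hρ : Measurable ρ :=
      measurable_id.prodMap (measurable_pi_iff.2 fun n => measurable_pi_apply _)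
    refine ⟨ρ ⁻¹' u, hρ hu, ?_⟩
    rw [← hut]
    ext ⟨x, y⟩
    simp [ρ]

/-- A measurable function on a product, with values in a standard Borel space, depends on the second
variable only through a measurable map to Cantor space. -/
theorem exists_factor_natBool {A E Z : Type*} [MeasurableSpace A] [MeasurableSpace E]
    [MeasurableSpace Z] [StandardBorelSpace Z] [Nonempty Z] {f : A × E → Z} (hf : Measurable f) :
    ∃ (ψ : E → ℕ → Bool) (F : A × (ℕ → Bool) → Z), Measurable ψ ∧ Measurable F ∧
      ∀ a x, f (a, x) = F (a, ψ x) := by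
  choose ψ hψ h using fun n => exists_preimage_natBool
    (hf (show MeasurableSet (MeasurableSpace.natGeneratingSequence Z n) from
      MeasurableSpace.measurableSet_natGeneratingSequence n))
  let Ψ : E → ℕ → Bool := fun x n => ψ n.unpair.1 x n.unpair.2
  have hΨ : Measurable Ψ := measurable_pi_iff.2 fun n => (measurable_pi_apply _).comp (hψ _)
  have hm : Measurable[(inferInstance : MeasurableSpace (A × (ℕ → Bool))).comap (Prod.map id Ψ)]
      f := by
    rw [← MeasurableSpace.generateFrom_natGeneratingSequence Z]
    refine @measurable_generateFrom _ _ (_) _ _ ?_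
    rintro _ ⟨i, rfl⟩
    obtain ⟨u, hu, hut⟩ := h i
    let ρ : A × (ℕ → Bool) → A × (ℕ → Bool) := Prod.map id fun y n => y (Nat.pair i n)
    have hρ : Measurable ρ :=
      measurable_id.prodMap (measurable_pi_iff.2 fun n => measurable_pi_apply _)
    refine ⟨ρ ⁻¹' u, hρ hu, ?_⟩
    rw [← hut]
    ext ⟨x, y⟩
    simp [ρ, Ψ]
  obtain ⟨F, hF, hfF⟩ := hm.exists_eq_measurable_comp
  exact ⟨Ψ, F, hΨ, hF, fun a x => congrFun hfF (a, x)⟩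

lemma exists_measurable_surjective_natSeq (Z : Type*) [MeasurableSpace Z] [StandardBorelSpace Z]
    [Nonempty Z] : ∃ ρ : (ℕ → ℕ) → Z, Measurable ρ ∧ Function.Surjective ρ := by
  let := upgradeStandardBorel Z
  obtain ⟨ρ, hρ, hρs⟩ := PolishSpace.exists_nat_nat_continuous_surjective Z
  exact ⟨ρ, hρ.measurable, hρs⟩

end Coding

/-! ### Extended expectations -/

section ExtExpectation

open Set Filter

variable {α β : Type*} [MeasurableSpace α] [MeasurableSpace β] {μ : Measure α} {ν : Measure β}

lemma EReal.coe_sub_coe_eq_of_add_eq {a b p n : ENNReal} (ha : a ≠ ⊤) (hp : p ≠ ⊤)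
    (h : a + n = p + b) : (a : EReal) - b = p - n := by
  lift a to NNReal using ha
  lift p to NNReal using hp
  rcases eq_or_ne n ⊤ with rfl | hn
  · have hb : b = ⊤ := by simpa using h.symm
    rw [hb]
    rfl
  · have hb : b ≠ ⊤ := by
      rintro rfl
      lift n to NNReal using hn
      simp [← ENNReal.coe_add] at h
    lift n to NNReal using hn
    lift b to NNReal using hb
    have h' : (a : ℝ) + n = p + b := by exact_mod_cast h
    change ((a : ℝ) : EReal) - ((b : ℝ) : EReal) = ((p : ℝ) : EReal) - ((n : ℝ) : EReal)
    rw [← EReal.coe_sub, ← EReal.coe_sub, EReal.coe_eq_coe_iff]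
    linarith

/-- The positive parts of an extended real number and of its opposite, for `p - n` with the
convention `⊤ - n = ⊤`. -/
lemma EReal.toENNReal_ite_sub_add (p n : ENNReal) :
    (if p = ⊤ then (⊤ : EReal) else p - n).toENNReal + n
      = p + (-(if p = ⊤ then (⊤ : EReal) else p - n)).toENNReal := by
  by_cases hp : p = ⊤
  · simp [hp]
  · have h1 : ((p : EReal) - n).toENNReal = p - n := by
      rw [EReal.toENNReal_sub (by positivity)]; simp
    have h2 : (-((p : EReal) - n)).toENNReal = n - p := by
      rw [EReal.neg_sub (Or.inl (by simp)) (Or.inl (by simpa using hp)), add_comm,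
        ← sub_eq_add_neg, EReal.toENNReal_sub (by positivity)]
      simp
    rw [if_neg hp, h1, h2, tsub_add_eq_max, add_tsub_eq_max]

lemma EReal.toENNReal_coe_add_add (c : ℝ) (x : EReal) :
    ((c : EReal) + x).toENNReal + ((-x).toENNReal + ENNReal.ofReal (-c))
      = (x.toENNReal + ENNReal.ofReal c) + (-((c : EReal) + x)).toENNReal := by
  induction x with
  | bot => simp
  | top => simp
  | coe x =>
    rw [← EReal.coe_add, ← EReal.coe_neg, ← EReal.coe_neg]
    simp only [EReal.real_coe_toENNReal]
    simp only [ENNReal.ofReal]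
    norm_cast
    rw [← NNReal.coe_inj]
    push_cast [Real.coe_toNNReal']
    have h : ∀ y : ℝ, max y 0 - max (-y) 0 = y := max_zero_sub_max_neg_zero_eq_self
    linarith [h (c + x), h c, h x]

lemma extExpectation_of_lintegral_eq_top {f : α → EReal}
    (h : ∫⁻ x, (f x).toENNReal ∂μ = ⊤) : extExpectation μ f = ⊤ := by
  rw [extExpectation, if_pos h]

lemma extExpectation_of_lintegral_ne_top {f : α → EReal}
    (h : ∫⁻ x, (f x).toENNReal ∂μ ≠ ⊤) : extExpectation μ f
      = ((∫⁻ x, (f x).toENNReal ∂μ : ENNReal) : EReal)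
        - ((∫⁻ x, (-f x).toENNReal ∂μ : ENNReal) : EReal) := by
  rw [extExpectation, if_neg h]

lemma lintegral_ne_top_of_extExpectation_ne_top {f : α → EReal} (h : extExpectation μ f ≠ ⊤) :
    ∫⁻ x, (f x).toENNReal ∂μ ≠ ⊤ := fun h' => h (extExpectation_of_lintegral_eq_top h')

lemma extExpectation_mono_ae {f g : α → EReal} (h : ∀ᵐ x ∂μ, f x ≤ g x) :
    extExpectation μ f ≤ extExpectation μ g := by
  have h1 : ∫⁻ x, (f x).toENNReal ∂μ ≤ ∫⁻ x, (g x).toENNReal ∂μ :=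
    lintegral_mono_ae (h.mono fun x hx => EReal.toENNReal_le_toENNReal hx)
  have h2 : ∫⁻ x, (-g x).toENNReal ∂μ ≤ ∫⁻ x, (-f x).toENNReal ∂μ :=
    lintegral_mono_ae (h.mono fun x hx => EReal.toENNReal_le_toENNReal (EReal.neg_le_neg_iff.2 hx))
  by_cases hg : ∫⁻ x, (g x).toENNReal ∂μ = ⊤
  · rw [extExpectation_of_lintegral_eq_top hg]
    exact le_top
  · rw [extExpectation_of_lintegral_ne_top hg,
      extExpectation_of_lintegral_ne_top (ne_top_of_le_ne_top hg h1)]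
    exact EReal.sub_le_sub (by exact_mod_cast h1) (by exact_mod_cast h2)

lemma extExpectation_const [IsProbabilityMeasure μ] (c : EReal) :
    extExpectation μ (fun _ => c) = c := by
  simp only [extExpectation, lintegral_const, measure_univ, mul_one]
  induction c with
  | bot => simp
  | top => simp
  | coe c =>
    rw [← EReal.coe_neg]
    simp only [EReal.real_coe_toENNReal, ENNReal.ofReal_ne_top, if_false, EReal.coe_ennreal_ofReal]
    rw [← EReal.coe_sub, max_zero_sub_max_neg_zero_eq_self]

lemma extExpectation_coe_add [IsProbabilityMeasure μ] (c : ℝ) {f : α → EReal}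
    (hf : AEMeasurable f μ) :
    extExpectation μ (fun x => (c : EReal) + f x) = c + extExpectation μ f := by
  have hcf : AEMeasurable (fun x => (c : EReal) + f x) μ := hf.const_add _
  have hn : AEMeasurable (fun x => (-f x).toENNReal) μ := hf.neg.ereal_toENNReal
  have key : ∫⁻ x, ((c : EReal) + f x).toENNReal ∂μ
        + (∫⁻ x, (-f x).toENNReal ∂μ + ENNReal.ofReal (-c))
      = (∫⁻ x, (f x).toENNReal ∂μ + ENNReal.ofReal c)
        + ∫⁻ x, (-((c : EReal) + f x)).toENNReal ∂μ := by
    have h := lintegral_congr (μ := μ) fun x => EReal.toENNReal_coe_add_add c (f x)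
    rw [lintegral_add_left' hcf.ereal_toENNReal, lintegral_add_left' hn,
      lintegral_add_left' (hf.ereal_toENNReal.add_const _), lintegral_add_left' hf.ereal_toENNReal]
      at h
    simpa using h
  have hle : ∫⁻ x, ((c : EReal) + f x).toENNReal ∂μ
      ≤ ENNReal.ofReal c + ∫⁻ x, (f x).toENNReal ∂μ := by
    calc _ ≤ ∫⁻ x, (ENNReal.ofReal c + (f x).toENNReal) ∂μ :=
          lintegral_mono fun x => by simpa using EReal.toENNReal_add_le (x := (c : EReal)) (y := f x)
      _ = _ := by rw [lintegral_add_left' aemeasurable_const]; simp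
  have hle' : ∫⁻ x, (f x).toENNReal ∂μ
      ≤ ENNReal.ofReal (-c) + ∫⁻ x, ((c : EReal) + f x).toENNReal ∂μ := by
    calc _ ≤ ∫⁻ x, (ENNReal.ofReal (-c) + ((c : EReal) + f x).toENNReal) ∂μ :=
          lintegral_mono fun x => by
            have := EReal.toENNReal_add_le (x := ((-c : ℝ) : EReal)) (y := (c : EReal) + f x)
            rw [← add_assoc, ← EReal.coe_add, neg_add_cancel] at this
            simpa using this
      _ = _ := by rw [lintegral_add_left' aemeasurable_const]; simp
  by_cases hp : ∫⁻ x, (f x).toENNReal ∂μ = ⊤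
  · have : ∫⁻ x, ((c : EReal) + f x).toENNReal ∂μ = ⊤ := by
      rw [hp] at hle'
      simpa using hle'
    rw [extExpectation_of_lintegral_eq_top hp, extExpectation_of_lintegral_eq_top this]
    simp
  · have ha : ∫⁻ x, ((c : EReal) + f x).toENNReal ∂μ ≠ ⊤ :=
      ne_top_of_le_ne_top (ENNReal.add_ne_top.2 ⟨ENNReal.ofReal_ne_top, hp⟩) hle
    rw [extExpectation_of_lintegral_ne_top hp, extExpectation_of_lintegral_ne_top ha,
      EReal.coe_sub_coe_eq_of_add_eq ha (ENNReal.add_ne_top.2 ⟨hp, ENNReal.ofReal_ne_top⟩) key]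
    lift ∫⁻ x, (f x).toENNReal ∂μ to NNReal using hp with p
    by_cases hN : ∫⁻ x, (-f x).toENNReal ∂μ = ⊤
    · simp [hN, EReal.sub_top]
    · lift ∫⁻ x, (-f x).toENNReal ∂μ to NNReal using hN with n
      simp only [EReal.coe_ennreal_add, EReal.coe_ennreal_ofReal]
      change (((p : ℝ) : EReal) + _) - (((n : ℝ) : EReal) + _)
        = (c : EReal) + (((p : ℝ) : EReal) - ((n : ℝ) : EReal))
      norm_cast
      linarith [max_zero_sub_max_neg_zero_eq_self c]

lemma EReal.neg_le_coe_add_neg {x y : EReal} {ε : ℝ} (h : y ≤ x + ε) : -x ≤ (ε : EReal) + -y := by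
  induction x with
  | bot => simp_all
  | top => simp
  | coe x =>
    induction y with
    | bot => simp
    | top =>
      rw [← EReal.coe_add] at h
      exact absurd h (not_le.2 (EReal.coe_lt_top _))
    | coe y =>
      norm_cast at h ⊢
      linarith

/-- A function within a constant above of which lies a function with well-defined expectation has a
well-defined expectation. -/
lemma HasExtExpectation.of_le_of_le_add [IsFiniteMeasure μ] {f q : α → EReal} {ε : ℝ}
    (hf : AEMeasurable f μ) (hq : HasExtExpectation μ q) (h1 : ∀ᵐ x ∂μ, f x ≤ q x)
    (h2 : ∀ᵐ x ∂μ, q x ≤ f x + ε) : HasExtExpectation μ f := by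
  refine ⟨hf, hq.2.imp (fun h => ne_top_of_le_ne_top h ?_) fun h => ?_⟩
  · exact lintegral_mono_ae (h1.mono fun x hx => EReal.toENNReal_le_toENNReal hx)
  · have hle : ∫⁻ x, (-f x).toENNReal ∂μ
        ≤ ∫⁻ x, (ENNReal.ofReal ε + (-q x).toENNReal) ∂μ := by
      refine lintegral_mono_ae (h2.mono fun x hx => ?_)
      have h3 : -f x ≤ (ε : EReal) + -q x := EReal.neg_le_coe_add_neg hx
      simpa using (EReal.toENNReal_le_toENNReal h3).trans EReal.toENNReal_add_le
    rw [lintegral_add_left' aemeasurable_const, lintegral_const] at hle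
    refine ne_top_of_le_ne_top (ENNReal.add_ne_top.2 ⟨?_, h⟩) hle
    exact ENNReal.mul_ne_top ENNReal.ofReal_ne_top (measure_ne_top μ _)

lemma lintegral_neg_toENNReal_map {φ : β → α} (hφ : AEMeasurable φ ν) {f : α → EReal}
    (hf : AEMeasurable f (ν.map φ)) :
    ∫⁻ x, (-f x).toENNReal ∂ν.map φ = ∫⁻ y, (-f (φ y)).toENNReal ∂ν :=
  lintegral_map' (f := fun x => (-f x).toENNReal) hf.neg.ereal_toENNReal hφ

lemma extExpectation_map {φ : β → α} (hφ : AEMeasurable φ ν) {f : α → EReal}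
    (hf : AEMeasurable f (ν.map φ)) :
    extExpectation (ν.map φ) f = extExpectation ν (f ∘ φ) := by
  simp only [extExpectation, lintegral_map' hf.ereal_toENNReal hφ,
    lintegral_neg_toENNReal_map hφ hf, Function.comp_apply]

lemma hasExtExpectation_map_iff {φ : β → α} (hφ : AEMeasurable φ ν) {f : α → EReal}
    (hf : AEMeasurable f (ν.map φ)) :
    HasExtExpectation (ν.map φ) f ↔ HasExtExpectation ν (f ∘ φ) := by
  have h1 := hf.comp_aemeasurable hφ
  simp only [HasExtExpectation, lintegral_map' hf.ereal_toENNReal hφ,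
    lintegral_neg_toENNReal_map hφ hf, Function.comp_apply, hf, h1, true_and]

lemma Measurable.extExpectation_prod_right [SFinite ν] {Z : α × β → EReal} (hZ : Measurable Z) :
    Measurable fun x => extExpectation ν fun y => Z (x, y) := by
  have hp : Measurable fun x => ∫⁻ y, (Z (x, y)).toENNReal ∂ν :=
    hZ.ereal_toENNReal.lintegral_prod_right'
  have hn : Measurable fun x => ∫⁻ y, (-Z (x, y)).toENNReal ∂ν :=
    hZ.neg.ereal_toENNReal.lintegral_prod_right'
  refine Measurable.ite (hp (measurableSet_singleton ⊤)) measurable_const ?_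
  simp_rw [sub_eq_add_neg]
  exact hp.coe_ereal_ennreal.add hn.coe_ereal_ennreal.neg

/-- **Fubini's theorem** for extended expectations. -/
lemma HasExtExpectation.extExpectation_prod [SFinite μ] [SFinite ν] {Z : α × β → EReal}
    (hZ : Measurable Z) (h : HasExtExpectation (μ.prod ν) Z) :
    HasExtExpectation μ (fun x => extExpectation ν fun y => Z (x, y)) ∧
      extExpectation (μ.prod ν) Z
        = extExpectation μ fun x => extExpectation ν fun y => Z (x, y) := by
  set p : α → ENNReal := fun x => ∫⁻ y, (Z (x, y)).toENNReal ∂ν with hpdef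
  set n : α → ENNReal := fun x => ∫⁻ y, (-Z (x, y)).toENNReal ∂ν with hndef
  set q : α → EReal := fun x => extExpectation ν fun y => Z (x, y) with hqdef
  have hp : Measurable p := hZ.ereal_toENNReal.lintegral_prod_right'
  have hn : Measurable n := hZ.neg.ereal_toENNReal.lintegral_prod_right'
  have hq : Measurable q := hZ.extExpectation_prod_right
  have hqpn : ∀ x, q x = if p x = ⊤ then (⊤ : EReal) else p x - n x := fun x => by
    simp only [hqdef, extExpectation, hpdef, hndef]
  have hP : ∫⁻ z, (Z z).toENNReal ∂μ.prod ν = ∫⁻ x, p x ∂μ :=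
    lintegral_prod _ hZ.ereal_toENNReal.aemeasurable
  have hN : ∫⁻ z, (-Z z).toENNReal ∂μ.prod ν = ∫⁻ x, n x ∂μ :=
    lintegral_prod _ hZ.neg.ereal_toENNReal.aemeasurable
  have h2 := h.2
  rw [hP, hN] at h2
  have key : ∫⁻ x, (q x).toENNReal ∂μ + ∫⁻ x, n x ∂μ
      = ∫⁻ x, p x ∂μ + ∫⁻ x, (-q x).toENNReal ∂μ := by
    rw [← lintegral_add_left hq.ereal_toENNReal, ← lintegral_add_left hp]
    refine lintegral_congr fun x => ?_
    simpa only [hqpn] using EReal.toENNReal_ite_sub_add _ _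
  have hqp : ∫⁻ x, (q x).toENNReal ∂μ ≤ ∫⁻ x, p x ∂μ := by
    refine lintegral_mono fun x => ?_
    simp only [hqpn]
    split_ifs with hx
    · simp [hx]
    · rw [EReal.toENNReal_sub (by positivity)]; simp
  by_cases hPt : ∫⁻ x, p x ∂μ = ⊤
  · have hNt : ∫⁻ x, n x ∂μ ≠ ⊤ := h2.resolve_left (not_not.2 hPt)
    have hqt : ∫⁻ x, (q x).toENNReal ∂μ = ⊤ := by
      rw [hPt, top_add] at key
      exact (ENNReal.add_eq_top.1 key).resolve_right hNt
    refine ⟨⟨hq.aemeasurable, Or.inr ?_⟩, ?_⟩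
    · refine ne_top_of_le_ne_top hNt (lintegral_mono fun x => ?_)
      simp only [hqpn]
      split_ifs with hx'
      · simp
      · rw [EReal.neg_sub (Or.inl (by simp)) (Or.inl (by simpa using hx')), add_comm,
          ← sub_eq_add_neg, EReal.toENNReal_sub (by positivity)]
        simp
    · rw [extExpectation_of_lintegral_eq_top hqt, extExpectation_of_lintegral_eq_top (hP.trans hPt)]
  · have hqt := ne_top_of_le_ne_top hPt hqp
    refine ⟨⟨hq.aemeasurable, Or.inl hqt⟩, ?_⟩
    rw [extExpectation_of_lintegral_ne_top hqt,
      extExpectation_of_lintegral_ne_top (by rwa [hP]), hP, hN,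
      EReal.coe_sub_coe_eq_of_add_eq hqt hPt key]

end ExtExpectation

/-! ### Policies on the space of noise paths -/

section Policies

open Set Filter

/-- The paths of a noise process. -/
abbrev NoisePath (E : ℕ → Type*) := ∀ k, E k

/-- The path that follows `a` up to time `t` and `e` afterwards. -/
def mixPath {E : ℕ → Type*} (t : ℕ) (a e : NoisePath E) : NoisePath E :=
  fun k => if k ≤ t then a k else e k

section MixPath

variable {E : ℕ → Type*} {t k : ℕ} (a e : NoisePath E)

lemma mixPath_of_le (h : k ≤ t) : mixPath t a e k = a k := if_pos h

lemma mixPath_of_lt (h : t < k) : mixPath t a e k = e k := if_neg h.not_ge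

lemma measurable_mixPath [∀ k, MeasurableSpace (E k)] (t : ℕ) :
    Measurable fun p : NoisePath E × NoisePath E => mixPath t p.1 p.2 := by
  refine measurable_pi_iff.2 fun k => ?_
  by_cases h : k ≤ t
  · simp only [mixPath, if_pos h]
    exact (measurable_pi_apply k).comp measurable_fst
  · simp only [mixPath, if_neg h]
    exact (measurable_pi_apply k).comp measurable_snd

end MixPath

variable {T : ℕ} {X U E R : ℕ → Type*}
  [∀ t, MeasurableSpace (X t)] [∀ t, MeasurableSpace (U t)]
  [∀ t, MeasurableSpace (E t)] [∀ t, MeasurableSpace (R t)]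

/-- `h` is a nonanticipative policy from time `t` on: at every time `s ≥ t` the control is a
measurable function of the noises up to time `s`. -/
structure IsPolicy (t : ℕ) (h : ∀ s, NoisePath E → U s) : Prop where
  measurable : ∀ s, Measurable (h s)
  congr : ∀ s, t ≤ s → ∀ e e' : NoisePath E, (∀ k ≤ s, e k = e' k) → h s e = h s e'

/-- The policy `h` in which the noises up to time `t` are frozen at the values given by `a`. -/
def freezePolicy (t : ℕ) (a : NoisePath E) (h : ∀ s, NoisePath E → U s) :
    ∀ s, NoisePath E → U s := fun s e => h s (mixPath t a e)

lemma IsPolicy.freeze {t t' : ℕ} (htt' : t ≤ t') {h : ∀ s, NoisePath E → U s} (hh : IsPolicy t h)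
    (a : NoisePath E) : IsPolicy t' (freezePolicy t' a h) where
  measurable s := (hh.measurable s).comp ((measurable_mixPath t').comp measurable_prodMk_left)
  congr s hs e e' hee' := hh.congr s (htt'.trans hs) _ _ fun k hk => by
    by_cases hkt : k ≤ t'
    · rw [mixPath_of_le _ _ hkt, mixPath_of_le _ _ hkt]
    · rw [mixPath_of_lt _ _ (not_le.1 hkt), mixPath_of_lt _ _ (not_le.1 hkt), hee' k hk]

variable [∀ t, Nonempty (X t)]

/-- The state at time `s` when the policy `h` is followed from the state `x` at time `t`
(an arbitrary value for `s < t`). -/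
noncomputable def policyState (D : LocalData T X U E R) (t : ℕ) (x : X t)
    (h : ∀ s, NoisePath E → U s) : ∀ s, NoisePath E → X s
  | 0, _ => if h0 : 0 = t then h0 ▸ x else Classical.arbitrary _
  | s + 1, e =>
    if hs : s + 1 = t then hs ▸ x else D.g s (policyState D t x h s e) (h s e) (e (s + 1))

/-- The total cost from time `t` on when the policy `h` is followed from the state `x`. -/
noncomputable def policyCost (D : LocalData T X U E R) (t : ℕ) (x : X t)
    (h : ∀ s, NoisePath E → U s) (e : NoisePath E) : EReal :=
  ∑ s ∈ Finset.Ico t T, D.L s (policyState D t x h s e) (h s e) (e (s + 1))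
    + D.K (policyState D t x h T e)

/-- The policy `h`, followed from the state `x` at time `t`, satisfies the resource constraints
almost surely. -/
def IsFeasible (D : LocalData T X U E R) (ν : Measure (NoisePath E)) (r : ∀ t, R t) (t : ℕ) (x : X t)
    (h : ∀ s, NoisePath E → U s) : Prop :=
  ∀ s, t ≤ s → s < T → ∀ᵐ e ∂ν, D.Θ s (policyState D t x h s e) (h s e) = r s

/-- The expected cost of a policy, `+∞` if it is not feasible. -/
noncomputable def policyValue (D : LocalData T X U E R) (ν : Measure (NoisePath E)) (r : ∀ t, R t)
    (t : ℕ) (x : X t) (h : ∀ s, NoisePath E → U s) : EReal :=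
  ⨅ _ : IsFeasible D ν r t x h, extExpectation ν (policyCost D t x h)

/-- The infimum of the expected costs of all policies from the state `x` at time `t`. -/
noncomputable def optimalValue (D : LocalData T X U E R) (ν : Measure (NoisePath E)) (r : ∀ t, R t)
    (t : ℕ) (x : X t) : EReal :=
  ⨅ (h : ∀ s, NoisePath E → U s) (_ : IsPolicy t h), policyValue D ν r t x h

variable {D : LocalData T X U E R} {t : ℕ}

lemma policyState_self (x : X t) (h : ∀ s, NoisePath E → U s) (e : NoisePath E) :
    policyState D t x h t e = x := by
  cases t <;> simp [policyState]

lemma policyState_succ (x : X t) (h : ∀ s, NoisePath E → U s) (e : NoisePath E) {s : ℕ}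
    (hs : t ≤ s) : policyState D t x h (s + 1) e
      = D.g s (policyState D t x h s e) (h s e) (e (s + 1)) := by
  rw [policyState, dif_neg (by omega)]

lemma policyCost_horizon (x : X T) (h : ∀ s, NoisePath E → U s) (e : NoisePath E) :
    policyCost D T x h e = D.K x := by
  simp [policyCost, policyState_self]

lemma EReal.sum_ne_bot {ι : Type*} (s : Finset ι) {f : ι → EReal} (hf : ∀ i ∈ s, f i ≠ ⊥) :
    ∑ i ∈ s, f i ≠ ⊥ := by
  classical
  induction s using Finset.induction_on with
  | empty => simp
  | insert i s hi ih =>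
    rw [Finset.sum_insert hi]
    exact mt EReal.add_eq_bot_iff.1 (not_or.2 ⟨hf i (Finset.mem_insert_self i s),
      ih fun j hj => hf j (Finset.mem_insert_of_mem hj)⟩)

lemma policyCost_ne_bot (x : X t) (h : ∀ s, NoisePath E → U s) (e : NoisePath E) :
    policyCost D t x h e ≠ ⊥ :=
  mt EReal.add_eq_bot_iff.1 (not_or.2
    ⟨EReal.sum_ne_bot _ fun s hs => D.L_ne_bot s (Finset.mem_Ico.1 hs).2 _ _ _, D.K_ne_bot _⟩)

lemma policyState_congr {h : ∀ s, NoisePath E → U s} (hh : IsPolicy t h) (x : X t) {s : ℕ}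
    (hs : t ≤ s) {e e' : NoisePath E} (hee' : ∀ k ≤ s, e k = e' k) :
    policyState D t x h s e = policyState D t x h s e' := by
  induction s, hs using Nat.le_induction with
  | base => rw [policyState_self, policyState_self]
  | succ s hs ih =>
    rw [policyState_succ _ _ _ hs, policyState_succ _ _ _ hs,
      ih fun k hk => hee' k (hk.trans s.le_succ),
      hh.congr s hs e e' fun k hk => hee' k (hk.trans s.le_succ),
      hee' (s + 1) le_rfl]

/-- Flow property: with the noises frozen up to time `t'`, the state process restarts from the state
reached at time `t'`. -/
lemma policyState_mixPath {h : ∀ s, NoisePath E → U s} (hh : IsPolicy t h) (x : X t) {t' s : ℕ}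
    (htt' : t ≤ t') (hs : t' ≤ s) (a e : NoisePath E) :
    policyState D t x h s (mixPath t' a e)
      = policyState D t' (policyState D t x h t' a) (freezePolicy t' a h) s e := by
  induction s, hs using Nat.le_induction with
  | base =>
    rw [policyState_self]
    exact policyState_congr hh x htt' fun k hk => mixPath_of_le a e hk
  | succ s hs ih =>
    rw [policyState_succ _ _ _ (htt'.trans hs), policyState_succ _ _ _ hs, ih,
      mixPath_of_lt _ _ (by omega)]
    rfl

lemma policyCost_mixPath_self {h : ∀ s, NoisePath E → U s} (hh : IsPolicy t h) (x : X t)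
    (htT : t ≤ T) (a e : NoisePath E) :
    policyCost D t x h (mixPath t a e) = policyCost D t x (freezePolicy t a h) e := by
  rw [policyCost, policyCost, policyState_mixPath hh x le_rfl htT, policyState_self]
  congr 1
  refine Finset.sum_congr rfl fun s hs => ?_
  have hts := (Finset.mem_Ico.1 hs).1
  rw [policyState_mixPath hh x le_rfl hts, policyState_self, mixPath_of_lt _ _ (by omega)]
  rfl

/-- Splitting off the first stage. -/
lemma policyCost_mixPath_succ {h : ∀ s, NoisePath E → U s} (hh : IsPolicy t h) (x : X t)
    (htT : t < T) (a e : NoisePath E) :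
    policyCost D t x h (mixPath (t + 1) a e) = D.L t x (h t a) (a (t + 1))
      + policyCost D (t + 1) (D.g t x (h t a) (a (t + 1))) (freezePolicy (t + 1) a h) e := by
  have hx : policyState D t x h (t + 1) a = D.g t x (h t a) (a (t + 1)) := by
    rw [policyState_succ _ _ _ le_rfl, policyState_self]
  have ht : h t (mixPath (t + 1) a e) = h t a :=
    hh.congr t le_rfl _ _ fun k hk => mixPath_of_le a e (by omega)
  rw [policyCost, policyCost, policyState_mixPath hh x t.le_succ htT, hx,
    Finset.sum_eq_sum_Ico_succ_bot htT, policyState_self, ht, mixPath_of_le _ _ le_rfl, add_assoc]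
  congr 2
  refine Finset.sum_congr rfl fun s hs => ?_
  have hts := (Finset.mem_Ico.1 hs).1
  rw [policyState_mixPath hh x t.le_succ hts, hx, mixPath_of_lt _ _ (by omega)]
  rfl

section Measurability

variable {A : Type*} [MeasurableSpace A] {x : A → X t} {h : ∀ s, A × NoisePath E → U s}

lemma measurable_policyState (hx : Measurable x) (hh : ∀ s, Measurable (h s)) {s : ℕ}
    (hts : t ≤ s) (hsT : s ≤ T) :
    Measurable fun p : A × NoisePath E =>
      policyState D t (x p.1) (fun s e => h s (p.1, e)) s p.2 := by
  induction s, hts using Nat.le_induction with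
  | base =>
    simp only [policyState_self]
    exact hx.comp measurable_fst
  | succ s hs ih =>
    simp only [policyState_succ _ _ _ hs]
    exact (D.measurable_g s hsT).comp ((ih (by omega)).prodMk
      ((hh s).prodMk ((measurable_pi_apply (s + 1)).comp measurable_snd)))

lemma measurable_policyCost (hx : Measurable x) (hh : ∀ s, Measurable (h s)) (htT : t ≤ T) :
    Measurable fun p : A × NoisePath E =>
      policyCost D t (x p.1) (fun s e => h s (p.1, e)) p.2 := by
  refine Measurable.add ?_ (D.measurable_K.comp (measurable_policyState hx hh htT le_rfl))
  refine Finset.measurable_fun_sum _ fun s hs => ?_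
  obtain ⟨h1, h2⟩ := Finset.mem_Ico.1 hs
  exact (D.measurable_L s h2).comp ((measurable_policyState hx hh h1 h2.le).prodMk
      ((hh s).prodMk ((measurable_pi_apply (s + 1)).comp measurable_snd)))

lemma IsPolicy.measurable_policyCost {h : ∀ s, NoisePath E → U s} (hh : IsPolicy t h) (x : X t)
    (htT : t ≤ T) : Measurable (policyCost D t x h) :=
  (_root_.measurable_policyCost (A := Unit) (x := fun _ => x) (h := fun s p => h s p.2)
    measurable_const (fun s => (hh.measurable s).comp measurable_snd) htT).comp
      measurable_prodMk_left (f := Prod.mk ())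

variable [∀ t, MeasurableSingletonClass (R t)] (r : ∀ t, R t)

lemma measurableSet_resource (hx : Measurable x) (hh : ∀ s, Measurable (h s)) {s : ℕ}
    (hts : t ≤ s) (hsT : s < T) : MeasurableSet {p : A × NoisePath E |
      D.Θ s (policyState D t (x p.1) (fun s e => h s (p.1, e)) s p.2) (h s (p.1, p.2)) = r s} :=
  ((D.measurable_Θ s hsT).comp ((measurable_policyState hx hh hts hsT.le).prodMk (hh s)))
    (measurableSet_singleton (r s))

lemma measurable_policyValue (ν : Measure (NoisePath E)) [SFinite ν] (hx : Measurable x)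
    (hh : ∀ s, Measurable (h s)) (htT : t ≤ T) :
    Measurable fun a : A => policyValue D ν r t (x a) (fun s e => h s (a, e)) := by
  classical
  have hS : MeasurableSet
      {a : A | IsFeasible D ν r t (x a) (fun s e => h s (a, e))} := by
    have : {a : A | IsFeasible D ν r t (x a) (fun s e => h s (a, e))}
        = ⋂ (s) (_ : t ≤ s) (_ : s < T), {a | ν (Prod.mk a ⁻¹' {p : A × NoisePath E |
          D.Θ s (policyState D t (x p.1) (fun s e => h s (p.1, e)) s p.2)
            (h s (p.1, p.2)) = r s}ᶜ) = 0} := by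
      ext a
      simp only [IsFeasible, mem_iInter]
      rfl
    rw [this]
    refine .iInter fun s => .iInter fun hts => .iInter fun hsT => ?_
    exact measurable_measure_prodMk_left (measurableSet_resource r hx hh hts hsT).compl
      (measurableSet_singleton 0)
  have : (fun a : A => policyValue D ν r t (x a) (fun s e => h s (a, e)))
      = fun a => if a ∈ {a : A | IsFeasible D ν r t (x a) (fun s e => h s (a, e))} then
        extExpectation ν (policyCost D t (x a) (fun s e => h s (a, e))) else ⊤ := by
    funext a
    by_cases ha : IsFeasible D ν r t (x a) (fun s e => h s (a, e))
    · simp [policyValue, ha]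
    · simp [policyValue, ha]
  rw [this]
  exact Measurable.ite hS (measurable_policyCost hx hh htT).extExpectation_prod_right
    measurable_const

lemma IsPolicy.measurableSet_resource {h : ∀ s, NoisePath E → U s} (hh : IsPolicy t h) (x : X t)
    {s : ℕ} (hts : t ≤ s) (hsT : s < T) :
    MeasurableSet {e | D.Θ s (policyState D t x h s e) (h s e) = r s} :=
  (_root_.measurableSet_resource (A := Unit) (x := fun _ => x) (h := fun s p => h s p.2) r
    measurable_const (fun s => (hh.measurable s).comp measurable_snd) hts hsT).preimage
      measurable_prodMk_left (f := Prod.mk ())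

end Measurability

end Policies

/-! ### The Bellman equation on the space of noise paths -/

section Bellman

open Set Filter

variable {T : ℕ} {X U E R : ℕ → Type*}
  [∀ t, MeasurableSpace (X t)] [∀ t, MeasurableSpace (U t)]
  [∀ t, MeasurableSpace (E t)] [∀ t, MeasurableSpace (R t)] [∀ t, Nonempty (X t)]

/-- Standing assumptions on a control problem whose noise path has law `ν`: the noises of different
times are independent (replacing the noises up to time `t` by those of an independent copy does
not change the law), the expected costs of feasible policies are well defined, and the optimal values
are not `-∞`. -/
structure IsWellPosed (D : LocalData T X U E R) (ν : Measure (NoisePath E)) (r : ∀ t, R t) :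
    Prop where
  map_mixPath : ∀ t ≤ T, (ν.prod ν).map (fun p => mixPath t p.1 p.2) = ν
  hasExtExpectation : ∀ t ≤ T, ∀ (x : X t) (h : ∀ s, NoisePath E → U s), IsPolicy t h →
    IsFeasible D ν r t x h → HasExtExpectation ν (policyCost D t x h)
  optimalValue_ne_bot : ∀ t ≤ T, ∀ x : X t, optimalValue D ν r t x ≠ ⊥

/-- The cost of stage `t` in the state `x` under the control `u`, completed with the optimal value of
the next state. -/
noncomputable def bellmanCost (D : LocalData T X U E R) (ν : Measure (NoisePath E)) (r : ∀ t, R t)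
    (t : ℕ) (x : X t) (u : U t) (e : NoisePath E) : EReal :=
  D.L t x u (e (t + 1)) + optimalValue D ν r (t + 1) (D.g t x u (e (t + 1)))

/-- The optimal values at time `t` are the infima over a jointly measurable family of
policies, indexed by Baire space, which depend on the noises of times after `t` only. In
particular the optimal value is a lower semianalytic function of the state. -/
def HasCodedPolicies (D : LocalData T X U E R) (ν : Measure (NoisePath E)) (r : ∀ t, R t) (t : ℕ) :
    Prop :=
  ∃ φ : ∀ s, (X t × (ℕ → ℕ)) × NoisePath E → U s,
    (∀ s, Measurable (φ s)) ∧
    (∀ s, t ≤ s → ∀ p e e', (∀ k, t < k → k ≤ s → e k = e' k) → φ s (p, e) = φ s (p, e')) ∧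
    ∀ x, optimalValue D ν r t x = ⨅ c, policyValue D ν r t x fun s e => φ s ((x, c), e)

variable {D : LocalData T X U E R} {ν : Measure (NoisePath E)} {r : ∀ t, R t} {t : ℕ}

lemma policyValue_of_isFeasible {x : X t} {h : ∀ s, NoisePath E → U s}
    (hf : IsFeasible D ν r t x h) :
    policyValue D ν r t x h = extExpectation ν (policyCost D t x h) := by
  simp [policyValue, hf]

lemma isFeasible_of_policyValue_ne_top {x : X t} {h : ∀ s, NoisePath E → U s}
    (hf : policyValue D ν r t x h ≠ ⊤) : IsFeasible D ν r t x h := by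
  by_contra hn
  exact hf (by simp [policyValue, hn])

lemma optimalValue_le {x : X t} {h : ∀ s, NoisePath E → U s} (hh : IsPolicy t h) :
    optimalValue D ν r t x ≤ policyValue D ν r t x h :=
  iInf₂_le h hh

lemma policyState_congr_policy (x : X t) {h h' : ∀ s, NoisePath E → U s}
    (hhh' : ∀ s, t ≤ s → h s = h' s) {s : ℕ} (hs : t ≤ s) (e : NoisePath E) :
    policyState D t x h s e = policyState D t x h' s e := by
  induction s, hs using Nat.le_induction with
  | base => rw [policyState_self, policyState_self]
  | succ s hs ih => rw [policyState_succ _ _ _ hs, policyState_succ _ _ _ hs, ih, hhh' s hs]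

lemma policyCost_congr_policy (x : X t) {h h' : ∀ s, NoisePath E → U s}
    (hhh' : ∀ s, t ≤ s → h s = h' s) (htT : t ≤ T) :
    policyCost D t x h = policyCost D t x h' := by
  funext e
  rw [policyCost, policyCost, policyState_congr_policy x hhh' htT]
  congr 1
  refine Finset.sum_congr rfl fun s hs => ?_
  have hts := (Finset.mem_Ico.1 hs).1
  rw [policyState_congr_policy x hhh' hts, hhh' s hts]

lemma isFeasible_congr_policy (x : X t) {h h' : ∀ s, NoisePath E → U s}
    (hhh' : ∀ s, t ≤ s → h s = h' s) : IsFeasible D ν r t x h ↔ IsFeasible D ν r t x h' := by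
  refine forall_congr' fun s => forall_congr' fun hs => forall_congr' fun _ => ?_
  simp only [policyState_congr_policy x hhh' hs, hhh' s hs]

lemma optimalValue_horizon [∀ t, Nonempty (U t)] [IsProbabilityMeasure ν] (x : X T) :
    optimalValue D ν r T x = D.K x := by
  have h1 : ∀ h : ∀ s, NoisePath E → U s, policyValue D ν r T x h = D.K x := fun h => by
    have hf : IsFeasible D ν r T x h := fun s h1 h2 => absurd h2 h1.not_gt
    rw [policyValue_of_isFeasible hf, funext (policyCost_horizon x h), extExpectation_const]
  refine le_antisymm ?_ (le_iInf₂ fun h _ => (h1 h).ge)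
  exact (optimalValue_le (h := fun s _ => Classical.arbitrary (U s))
    ⟨fun s => measurable_const, fun _ _ _ _ _ => rfl⟩).trans (h1 _).le

lemma hasCodedPolicies_horizon [∀ t, Nonempty (U t)] [IsProbabilityMeasure ν] : HasCodedPolicies D ν r T := by
  refine ⟨fun s _ => Classical.arbitrary (U s), fun s => measurable_const,
    fun _ _ _ _ _ _ => rfl, fun x => ?_⟩
  have hf : IsFeasible D ν r T x (fun s _ => Classical.arbitrary (U s)) :=
    fun s h1 h2 => absurd h2 h1.not_gt
  rw [optimalValue_horizon]
  change D.K x = ⨅ _ : ℕ → ℕ, policyValue D ν r T x fun s _ => Classical.arbitrary (U s)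
  rw [policyValue_of_isFeasible hf, funext (policyCost_horizon x _),
    extExpectation_const, iInf_const]

section Mixing

variable [IsProbabilityMeasure ν]

lemma ae_mixPath_iff (hmix : (ν.prod ν).map (fun p => mixPath t p.1 p.2) = ν)
    {S : Set (NoisePath E)} (hS : MeasurableSet S) :
    (∀ᵐ e ∂ν, e ∈ S) ↔ ∀ᵐ a ∂ν, ∀ᵐ e ∂ν, mixPath t a e ∈ S := by
  conv_lhs => rw [← hmix]
  rw [ae_map_iff (p := fun e => e ∈ S) (measurable_mixPath t).aemeasurable hS,
    Measure.ae_prod_iff_ae_ae (measurable_mixPath t hS)]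

/-- Fubini's theorem for the noises up to time `t` and after time `t`. -/
lemma HasExtExpectation.mixPath {Z : NoisePath E → EReal} (hZ : Measurable Z)
    (h : HasExtExpectation ν Z) (hmix : (ν.prod ν).map (fun p => mixPath t p.1 p.2) = ν) :
    HasExtExpectation ν (fun a => extExpectation ν fun e => Z (mixPath t a e)) ∧
      extExpectation ν Z = extExpectation ν fun a => extExpectation ν fun e => Z (mixPath t a e) := by
  rw [← hmix, hasExtExpectation_map_iff (measurable_mixPath t).aemeasurable hZ.aemeasurable] at h
  have := h.extExpectation_prod (hZ.comp (measurable_mixPath t))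
  refine ⟨this.1, Eq.trans ?_ this.2⟩
  conv_lhs => rw [← hmix]
  exact extExpectation_map (measurable_mixPath t).aemeasurable hZ.aemeasurable

end Mixing

lemma extExpectation_add_of_ne_bot [IsProbabilityMeasure ν] {c : EReal} (hc : c ≠ ⊥)
    {f : NoisePath E → EReal} (hf : Measurable f) (hbot : ∀ e, f e ≠ ⊥)
    (hEbot : extExpectation ν f ≠ ⊥) :
    extExpectation ν (fun e => c + f e) = c + extExpectation ν f := by
  induction c with
  | bot => exact absurd rfl hc
  | top =>
    simp only [EReal.top_add_of_ne_bot (hbot _), EReal.top_add_of_ne_bot hEbot]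
    exact extExpectation_const ⊤
  | coe c => exact extExpectation_coe_add c hf.aemeasurable

variable [∀ t, MeasurableSingletonClass (R t)] [IsProbabilityMeasure ν]

/-- A feasible policy remains feasible when the past is frozen at almost any of its values. -/
lemma IsFeasible.ae_freeze (hD : IsWellPosed D ν r) {h : ∀ s, NoisePath E → U s}
    (hh : IsPolicy t h) {x : X t} (hf : IsFeasible D ν r t x h) {t' : ℕ} (htt' : t ≤ t')
    (ht'T : t' ≤ T) :
    ∀ᵐ a ∂ν, IsFeasible D ν r t' (policyState D t x h t' a) (freezePolicy t' a h) := by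
  simp only [IsFeasible, ae_all_iff]
  intro s hs hsT
  have h1 := (ae_mixPath_iff (hD.map_mixPath t' ht'T)
    (hh.measurableSet_resource r x (htt'.trans hs) hsT)).1 (hf s (htt'.trans hs) hsT)
  filter_upwards [h1] with a ha
  filter_upwards [ha] with e he
  have he' : D.Θ s (policyState D t x h s (mixPath t' a e)) (h s (mixPath t' a e)) = r s := he
  rwa [policyState_mixPath hh x htt' hs] at he'

/-- The Bellman cost of the first control is a lower bound for the cost of a policy with a
deterministic first control. -/
lemma extExpectation_bellmanCost_le_of_const (hD : IsWellPosed D ν r) (htT : t < T) {x : X t} {u : U t}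
    {h : ∀ s, NoisePath E → U s} (hh : IsPolicy t h) (hu : ∀ e, h t e = u)
    (hf : IsFeasible D ν r t x h) :
    extExpectation ν (bellmanCost D ν r t x u) ≤ extExpectation ν (policyCost D t x h) := by
  have hfub := (hD.hasExtExpectation t htT.le x h hh hf).mixPath
    (hh.measurable_policyCost x htT.le) (hD.map_mixPath (t + 1) htT)
  rw [hfub.2]
  refine extExpectation_mono_ae ?_
  filter_upwards [hf.ae_freeze hD hh t.le_succ htT] with a ha
  have hx : policyState D t x h (t + 1) a = D.g t x u (a (t + 1)) := by
    rw [policyState_succ _ _ _ le_rfl, policyState_self, hu]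
  rw [hx] at ha
  have hha := hh.freeze t.le_succ a
  have hV : optimalValue D ν r (t + 1) (D.g t x u (a (t + 1)))
      ≤ extExpectation ν (policyCost D (t + 1) (D.g t x u (a (t + 1)))
        (freezePolicy (t + 1) a h)) := by
    rw [← policyValue_of_isFeasible ha]
    exact optimalValue_le hha
  simp only [policyCost_mixPath_succ hh x htT, hu]
  rw [extExpectation_add_of_ne_bot (D.L_ne_bot t htT _ _ _)
    (hha.measurable_policyCost _ htT) (policyCost_ne_bot _ _)
    (ne_bot_of_le_ne_bot (hD.optimalValue_ne_bot (t + 1) htT _) hV)]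
  exact add_le_add le_rfl hV

/-- The infimum of the Bellman costs is a lower bound for the optimal value. The first control of a
policy may be random, through the noises before the initial time; freezing these makes it
deterministic. -/
lemma iInf_bellmanCost_le_optimalValue (hD : IsWellPosed D ν r) (htT : t < T) (x : X t) :
    ⨅ (u : U t) (_ : D.Θ t x u = r t), extExpectation ν (bellmanCost D ν r t x u)
      ≤ optimalValue D ν r t x := by
  refine le_iInf₂ fun h hh => le_iInf fun hf => ?_
  have hfub := (hD.hasExtExpectation t htT.le x h hh hf).mixPath
    (hh.measurable_policyCost x htT.le) (hD.map_mixPath t htT.le)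
  rw [hfub.2]
  refine (extExpectation_const (μ := ν) _).ge.trans (extExpectation_mono_ae ?_)
  filter_upwards [hf.ae_freeze hD hh le_rfl htT.le] with a ha
  rw [policyState_self] at ha
  have hu : ∀ e, freezePolicy t a h t e = h t a := fun e =>
    hh.congr t le_rfl _ _ fun k hk => mixPath_of_le a e hk
  have hΘ : D.Θ t x (h t a) = r t := by
    obtain ⟨e, he⟩ := (ha t le_rfl htT).exists
    rwa [policyState_self, hu] at he
  simp only [policyCost_mixPath_self hh x htT.le]
  exact (iInf₂_le (h t a) hΘ).trans
    (extExpectation_bellmanCost_le_of_const hD htT (hh.freeze le_rfl a) hu ha)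

end Bellman

section Recursion

open Set Filter

variable {T : ℕ} {X U E R : ℕ → Type*}
  [∀ t, MeasurableSpace (X t)] [∀ t, MeasurableSpace (U t)]
  [∀ t, MeasurableSpace (E t)] [∀ t, MeasurableSpace (R t)]

/-- Apply the control `u` at time `t`, then choose a member of the family `φ` of policies from time
`t + 1`; its index `γ (c, e (t + 1))` may depend on the noise of time `t + 1`. -/
def consPolicy (D : LocalData T X U E R) (t : ℕ)
    (φ : ∀ s, (X (t + 1) × (ℕ → ℕ)) × NoisePath E → U s) (γ : (ℕ → ℕ) × E (t + 1) → ℕ → ℕ)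
    (x : X t) (u : U t) (c : ℕ → ℕ) : ∀ s, NoisePath E → U s :=
  Function.update (fun s e => φ s ((D.g t x u (e (t + 1)), γ (c, e (t + 1))), e)) t fun _ => u

variable {D : LocalData T X U E R} {t : ℕ}
  {φ : ∀ s, (X (t + 1) × (ℕ → ℕ)) × NoisePath E → U s} {γ : (ℕ → ℕ) × E (t + 1) → ℕ → ℕ}

lemma consPolicy_self (x : X t) (u : U t) (c : ℕ → ℕ) (e : NoisePath E) :
    consPolicy D t φ γ x u c t e = u := by
  simp [consPolicy]

lemma consPolicy_of_lt (x : X t) (u : U t) (c : ℕ → ℕ) (e : NoisePath E) {s : ℕ} (hs : t < s) :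
    consPolicy D t φ γ x u c s e = φ s ((D.g t x u (e (t + 1)), γ (c, e (t + 1))), e) := by
  simp [consPolicy, Function.update_of_ne hs.ne']

lemma measurable_consPolicy (htT : t < T) (hφ : ∀ s, Measurable (φ s)) (hγ : Measurable γ) (s : ℕ) :
    Measurable fun p : (X t × U t × (ℕ → ℕ)) × NoisePath E =>
      consPolicy D t φ γ p.1.1 p.1.2.1 p.1.2.2 s p.2 := by
  have he : Measurable fun p : (X t × U t × (ℕ → ℕ)) × NoisePath E => p.2 (t + 1) :=
    (measurable_pi_apply (t + 1)).comp measurable_snd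
  by_cases hs : s = t
  · subst hs
    simp only [consPolicy_self]
    fun_prop
  · simp only [consPolicy, Function.update_of_ne hs]
    refine (hφ s).comp (Measurable.prodMk (Measurable.prodMk ?_ ?_) measurable_snd)
    · exact (D.measurable_g t htT).comp (Measurable.prodMk (by fun_prop)
        (Measurable.prodMk (by fun_prop) he))
    · exact hγ.comp (Measurable.prodMk (by fun_prop) he)

lemma consPolicy_congr
    (hφ' : ∀ s, t + 1 ≤ s → ∀ p e e', (∀ k, t + 1 < k → k ≤ s → e k = e' k) →
      φ s (p, e) = φ s (p, e')) (x : X t) (u : U t) (c : ℕ → ℕ) {s : ℕ} (hs : t ≤ s)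
    {e e' : NoisePath E} (hee' : ∀ k, t < k → k ≤ s → e k = e' k) :
    consPolicy D t φ γ x u c s e = consPolicy D t φ γ x u c s e' := by
  rcases hs.eq_or_lt with rfl | hlt
  · rw [consPolicy_self, consPolicy_self]
  · rw [consPolicy_of_lt _ _ _ _ hlt, consPolicy_of_lt _ _ _ _ hlt,
      hee' (t + 1) t.lt_succ_self hlt]
    exact hφ' s hlt _ _ _ fun k hk hks => hee' k (t.lt_succ_self.trans hk) hks

lemma isPolicy_consPolicy (htT : t < T) (hφ : ∀ s, Measurable (φ s))
    (hφ' : ∀ s, t + 1 ≤ s → ∀ p e e', (∀ k, t + 1 < k → k ≤ s → e k = e' k) →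
      φ s (p, e) = φ s (p, e')) (hγ : Measurable γ) (x : X t) (u : U t) (c : ℕ → ℕ) :
    IsPolicy t (consPolicy D t φ γ x u c) where
  measurable s := (measurable_consPolicy htT hφ hγ s).comp
    (measurable_prodMk_left (x := (x, u, c)))
  congr _ hs _ _ hee' := consPolicy_congr hφ' x u c hs fun k _ hks => hee' k hks

lemma freezePolicy_consPolicy
    (hφ' : ∀ s, t + 1 ≤ s → ∀ p e e', (∀ k, t + 1 < k → k ≤ s → e k = e' k) →
      φ s (p, e) = φ s (p, e')) (x : X t) (u : U t) (c : ℕ → ℕ) (a : NoisePath E) {s : ℕ}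
    (hs : t + 1 ≤ s) : freezePolicy (t + 1) a (consPolicy D t φ γ x u c) s
      = fun e => φ s ((D.g t x u (a (t + 1)), γ (c, a (t + 1))), e) := by
  funext e
  rw [freezePolicy, consPolicy_of_lt _ _ _ _ hs, mixPath_of_le _ _ le_rfl]
  exact hφ' s hs _ _ _ fun k hk _ => mixPath_of_lt a e hk

variable [∀ t, Nonempty (X t)] [∀ t, MeasurableSingletonClass (R t)]
  {ν : Measure (NoisePath E)} [IsProbabilityMeasure ν] {r : ∀ t, R t}

/-- If almost every choice made by `consPolicy` at time `t + 1` is feasible, then so is the composed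
policy, and its cost is the expectation of the first-stage cost completed with the expected cost of
the chosen policy. -/
lemma consPolicy_spec (hD : IsWellPosed D ν r) (htT : t < T) (hφ : ∀ s, Measurable (φ s))
    (hφ' : ∀ s, t + 1 ≤ s → ∀ p e e', (∀ k, t + 1 < k → k ≤ s → e k = e' k) →
      φ s (p, e) = φ s (p, e')) (hγ : Measurable γ) {x : X t} {u : U t} (hu : D.Θ t x u = r t)
    {c : ℕ → ℕ}
    (hfeas : ∀ᵐ a ∂ν, IsFeasible D ν r (t + 1) (D.g t x u (a (t + 1)))
      fun s e => φ s ((D.g t x u (a (t + 1)), γ (c, a (t + 1))), e)) :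
    ∃ q : NoisePath E → EReal, HasExtExpectation ν q ∧
      policyValue D ν r t x (consPolicy D t φ γ x u c) = extExpectation ν q ∧
      ∀ᵐ a ∂ν, q a = D.L t x u (a (t + 1)) + policyValue D ν r (t + 1) (D.g t x u (a (t + 1)))
        fun s e => φ s ((D.g t x u (a (t + 1)), γ (c, a (t + 1))), e) := by
  set h := consPolicy D t φ γ x u c with hdef
  have hh : IsPolicy t h := isPolicy_consPolicy htT hφ hφ' hγ x u c
  have hx : ∀ a, policyState D t x h (t + 1) a = D.g t x u (a (t + 1)) := fun a => by
    rw [policyState_succ _ _ _ le_rfl, policyState_self, hdef, consPolicy_self]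
  have hfr : ∀ a s, t + 1 ≤ s → freezePolicy (t + 1) a h s
      = fun e => φ s ((D.g t x u (a (t + 1)), γ (c, a (t + 1))), e) := fun a s hs =>
    freezePolicy_consPolicy hφ' x u c a hs
  have hf : IsFeasible D ν r t x h := by
    intro s hs hsT
    rcases hs.eq_or_lt with rfl | hlt
    · refine Eventually.of_forall fun e => ?_
      rw [policyState_self, hdef, consPolicy_self, hu]
    · refine (ae_mixPath_iff (hD.map_mixPath (t + 1) htT)
        (hh.measurableSet_resource r x hs hsT)).2 ?_
      filter_upwards [hfeas] with a ha
      have ha' := (isFeasible_congr_policy _ (hfr a)).2 ha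
      filter_upwards [ha' s hlt hsT] with e he
      rw [policyState_mixPath hh x t.le_succ hlt, hx]
      exact he
  have hfub := (hD.hasExtExpectation t htT.le x h hh hf).mixPath
    (hh.measurable_policyCost x htT.le) (hD.map_mixPath (t + 1) htT)
  refine ⟨_, hfub.1, (policyValue_of_isFeasible hf).trans hfub.2, ?_⟩
  filter_upwards [hfeas] with a ha
  have ha' := (isFeasible_congr_policy _ (hfr a)).2 ha
  have hha := hh.freeze t.le_succ a
  have hha0 : h t a = u := consPolicy_self x u c a
  simp only [policyCost_mixPath_succ hh x htT, hha0]
  have hne : extExpectation ν (policyCost D (t + 1) (D.g t x u (a (t + 1)))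
      (freezePolicy (t + 1) a h)) ≠ ⊥ := by
    rw [← policyValue_of_isFeasible ha']
    exact ne_bot_of_le_ne_bot (hD.optimalValue_ne_bot (t + 1) htT _) (optimalValue_le hha)
  rw [extExpectation_add_of_ne_bot (D.L_ne_bot t htT _ _ _)
    (hha.measurable_policyCost _ htT) (policyCost_ne_bot _ _) hne,
    policyValue_of_isFeasible ha, policyCost_congr_policy _ (hfr a) htT]

/-- One step of the backward recursion. The Bellman cost is measurable up to a null set because the
optimal value of the next state is an infimum over a jointly measurable family; near-optimal members
of this family are selected measurably as functions of the noise of time `t + 1`, and such a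
selection is coded by a single element of Baire space. -/
lemma HasCodedPolicies.exists_consPolicy (hD : IsWellPosed D ν r) (htT : t < T)
    (hC : HasCodedPolicies D ν r (t + 1)) :
    ∃ (φ : ∀ s, (X (t + 1) × (ℕ → ℕ)) × NoisePath E → U s) (γ : (ℕ → ℕ) × E (t + 1) → ℕ → ℕ),
      (∀ s, Measurable (φ s)) ∧
      (∀ s, t + 1 ≤ s → ∀ p e e', (∀ k, t + 1 < k → k ≤ s → e k = e' k) →
        φ s (p, e) = φ s (p, e')) ∧ Measurable γ ∧
      ∀ (x : X t) (u : U t), D.Θ t x u = r t →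
        AEMeasurable (bellmanCost D ν r t x u) ν ∧
        ((∀ᵐ e ∂ν, bellmanCost D ν r t x u e ≠ ⊤) → ∀ ε : ℝ, 0 < ε →
          ∃ (c : ℕ → ℕ) (q : NoisePath E → EReal), HasExtExpectation ν q ∧
            policyValue D ν r t x (consPolicy D t φ γ x u c) = extExpectation ν q ∧
            (∀ᵐ e ∂ν, bellmanCost D ν r t x u e ≤ q e) ∧
            ∀ᵐ e ∂ν, q e ≤ bellmanCost D ν r t x u e + ε) := by
  obtain ⟨φ, hφ, hφ', hV⟩ := hC
  let C : X (t + 1) × (ℕ → ℕ) → EReal := fun p =>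
    policyValue D ν r (t + 1) p.1 fun s e => φ s (p, e)
  have hCm : Measurable C := measurable_policyValue r ν measurable_fst hφ htT
  have hg : Measurable fun p : (X t × U t × (ℕ → ℕ)) × E (t + 1) => D.g t p.1.1 p.1.2.1 p.2 :=
    (D.measurable_g t htT).comp (Measurable.prodMk (by fun_prop)
      (Measurable.prodMk (by fun_prop) measurable_snd))
  obtain ⟨ψ, F, hψ, hF, hCF⟩ := exists_factor_natBool
    (f := fun p : (X t × U t × (ℕ → ℕ)) × E (t + 1) => C (D.g t p.1.1 p.1.2.1 p.2, p.1.2.2))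
    (hCm.comp (hg.prodMk (by fun_prop)))
  obtain ⟨κ, hκ, hκu⟩ := exists_universal_measurable (ℕ → Bool) (ℕ → ℕ)
  refine ⟨φ, fun p => κ (p.1, ψ p.2), hφ, hφ',
    hκ.comp (measurable_fst.prodMk (hψ.comp measurable_snd)), fun x u hu => ?_⟩
  let G : (ℕ → Bool) × (ℕ → ℕ) → EReal := fun p => F ((x, u, p.2), p.1)
  have hG : Measurable G := hF.comp
    (Measurable.prodMk (Measurable.prodMk measurable_const
      (Measurable.prodMk measurable_const measurable_snd)) measurable_fst)
  have hVG : ∀ e : E (t + 1),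
      optimalValue D ν r (t + 1) (D.g t x u e) = ⨅ c, G (ψ e, c) := fun e => by
    rw [hV]
    exact iInf_congr fun c => hCF (x, u, c) e
  have hψt : Measurable fun e : NoisePath E => ψ (e (t + 1)) := hψ.comp (measurable_pi_apply _)
  have hLm : Measurable fun e : NoisePath E => D.L t x u (e (t + 1)) :=
    (D.measurable_L t htT).comp (measurable_const.prodMk
      (measurable_const.prodMk (measurable_pi_apply _)))
  constructor
  · refine hLm.aemeasurable.add ?_
    simp only [hVG]
    exact (aemeasurable_iInf_standardBorel (ν.map fun e => ψ (e (t + 1))) hG).comp_measurable hψt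
  intro htop ε hε
  obtain ⟨σ, hσ, hσle⟩ :=
    exists_measurable_ae_le_iInf_add (ν.map fun e => ψ (e (t + 1))) hG hε
  obtain ⟨c, hc⟩ := hκu (ν.map fun e => ψ (e (t + 1))) σ hσ
  have hsel : ∀ᵐ a ∂ν, policyValue D ν r (t + 1) (D.g t x u (a (t + 1)))
      (fun s e => φ s ((D.g t x u (a (t + 1)), κ (c, ψ (a (t + 1)))), e))
        ≤ optimalValue D ν r (t + 1) (D.g t x u (a (t + 1))) + ε := by
    filter_upwards [ae_of_ae_map hψt.aemeasurable hσle, ae_of_ae_map hψt.aemeasurable hc]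
      with a h1 h2
    rw [← hVG, ← h2] at h1
    refine Eq.trans_le ?_ (h1 (hD.optimalValue_ne_bot (t + 1) htT _))
    exact hCF (x, u, κ (c, ψ (a (t + 1)))) (a (t + 1))
  have hVtop : ∀ᵐ a ∂ν, optimalValue D ν r (t + 1) (D.g t x u (a (t + 1))) ≠ ⊤ := by
    filter_upwards [htop] with a ha hVa
    exact ha (by rw [bellmanCost, hVa, EReal.add_top_of_ne_bot (D.L_ne_bot t htT _ _ _)])
  obtain ⟨q, hq, hqv, hqa⟩ := consPolicy_spec (γ := fun p => κ (p.1, ψ p.2)) hD htT hφ hφ'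
    (hκ.comp (measurable_fst.prodMk (hψ.comp measurable_snd))) hu (c := c) (by
      filter_upwards [hsel, hVtop] with a h1 h2
      refine isFeasible_of_policyValue_ne_top (ne_top_of_le_ne_top ?_ h1)
      exact EReal.add_ne_top h2 (EReal.coe_ne_top ε))
  refine ⟨c, q, hq, hqv, ?_, ?_⟩
  · filter_upwards [hqa] with a ha
    rw [ha, bellmanCost, hV]
    exact add_le_add le_rfl (iInf_le _ _)
  · filter_upwards [hqa, hsel] with a ha h1
    rw [ha, bellmanCost, add_assoc]
    exact add_le_add le_rfl h1

/-- The **Bellman equation**, together with the facts that propagate it backward in time. -/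
theorem HasCodedPolicies.bellman [∀ t, Nonempty (U t)] [∀ t, StandardBorelSpace (U t)]
    (hD : IsWellPosed D ν r) (htT : t < T) (hC : HasCodedPolicies D ν r (t + 1)) :
    HasCodedPolicies D ν r t ∧
    (∀ x, optimalValue D ν r t x
      = ⨅ (u : U t) (_ : D.Θ t x u = r t), extExpectation ν (bellmanCost D ν r t x u)) ∧
    ∀ (x : X t) (u : U t), D.Θ t x u = r t →
      AEMeasurable (bellmanCost D ν r t x u) ν ∧
      ((∀ᵐ e ∂ν, bellmanCost D ν r t x u e ≠ ⊤) →
        HasExtExpectation ν (bellmanCost D ν r t x u)) := by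
  obtain ⟨φ, γ, hφ, hφ', hγ, hK⟩ := hC.exists_consPolicy hD htT
  have hle : ∀ (x : X t) (u : U t), D.Θ t x u = r t →
      ⨅ c, policyValue D ν r t x (consPolicy D t φ γ x u c)
        ≤ extExpectation ν (bellmanCost D ν r t x u) := by
    intro x u hu
    obtain ⟨hm, hsel⟩ := hK x u hu
    refine EReal.le_of_forall_lt_iff_le.1 fun z hz => ?_
    have hfin : ∀ᵐ e ∂ν, bellmanCost D ν r t x u e ≠ ⊤ :=
      (ae_lt_top' hm.ereal_toENNReal
        (lintegral_ne_top_of_extExpectation_ne_top (ne_top_of_lt hz))).mono fun e he =>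
          EReal.toENNReal_ne_top_iff.1 he.ne
    obtain ⟨ε, hε, hεz⟩ : ∃ ε : ℝ, 0 < ε ∧
        (ε : EReal) + extExpectation ν (bellmanCost D ν r t x u) ≤ z := by
      generalize extExpectation ν (bellmanCost D ν r t x u) = J at hz
      induction J with
      | bot => exact ⟨1, one_pos, by simp⟩
      | top => exact absurd hz (not_lt.2 le_top)
      | coe j =>
        refine ⟨z - j, sub_pos.2 (by exact_mod_cast hz), ?_⟩
        norm_cast
        simp
    obtain ⟨c, q, -, hqv, -, hq⟩ := hsel hfin ε hε
    refine (iInf_le _ c).trans ?_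
    rw [hqv]
    refine le_trans ?_ hεz
    rw [← extExpectation_coe_add ε hm]
    refine extExpectation_mono_ae (hq.mono fun e he => ?_)
    rwa [add_comm]
  have hge : ∀ (x : X t) (u : U t) c, optimalValue D ν r t x
      ≤ policyValue D ν r t x (consPolicy D t φ γ x u c) := fun x u c =>
    optimalValue_le (isPolicy_consPolicy htT hφ hφ' hγ x u c)
  have hlow := iInf_bellmanCost_le_optimalValue hD htT
  refine ⟨?_, fun x => ?_, fun x u hu => ⟨(hK x u hu).1, fun hfin => ?_⟩⟩
  · obtain ⟨ρ, hρ, hρs⟩ := exists_measurable_surjective_natSeq (U t × (ℕ → ℕ))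
    refine ⟨fun s p => consPolicy D t φ γ p.1.1 (ρ p.1.2).1 (ρ p.1.2).2 s p.2, fun s => ?_,
      fun s hs p e e' hee' => consPolicy_congr hφ' _ _ _ hs hee', fun x => ?_⟩
    · have hA : Measurable fun p : (X t × (ℕ → ℕ)) × NoisePath E =>
          ((p.1.1, ρ p.1.2), p.2) :=
        Measurable.prodMk (Measurable.prodMk (measurable_fst.comp measurable_fst)
          (hρ.comp (measurable_snd.comp measurable_fst))) measurable_snd
      exact (measurable_consPolicy (D := D) htT hφ hγ s).comp hA
    · refine le_antisymm (le_iInf fun d => hge x (ρ d).1 (ρ d).2) (le_trans ?_ (hlow x))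
      refine le_iInf₂ fun u hu => le_trans (le_iInf fun c => ?_) (hle x u hu)
      obtain ⟨d, hd⟩ := hρs (u, c)
      refine (iInf_le _ d).trans_eq ?_
      simp only [hd]
  · exact le_antisymm (le_iInf₂ fun u hu => (le_iInf fun c => hge x u c).trans (hle x u hu))
      (hlow x)
  · obtain ⟨c, q, hq, -, h1, h2⟩ := (hK x u hu).2 hfin 1 one_pos
    exact hq.of_le_of_le_add (hK x u hu).1 h1 h2

theorem IsWellPosed.hasCodedPolicies [∀ t, Nonempty (U t)] [∀ t, StandardBorelSpace (U t)]
    (hD : IsWellPosed D ν r) {t : ℕ} (htT : t ≤ T) : HasCodedPolicies D ν r t :=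
  Nat.decreasingInduction' (fun _ hk _ ih => (ih.bellman hD hk).1) htT hasCodedPolicies_horizon

end Recursion

/-! ### From the probability space to the space of noise paths -/

section Transfer

open Set Filter

section Noise

variable {Ω : Type*} {E : ℕ → Type*} {T : ℕ} {η : ∀ k, Ω → E k} {ω₀ : Ω}

/-- The path of the noise process `η`, made constant outside the times `1, …, T`. -/
def noisePath (η : ∀ k, Ω → E k) (T : ℕ) (ω₀ : Ω) (ω : Ω) : NoisePath E :=
  fun k => if 1 ≤ k ∧ k ≤ T then η k ω else η k ω₀

lemma noisePath_of_le {k : ℕ} (h1 : 1 ≤ k) (hT : k ≤ T) (ω : Ω) :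
    noisePath η T ω₀ ω k = η k ω := if_pos ⟨h1, hT⟩

lemma noisePath_of_not {k : ℕ} (hk : ¬(1 ≤ k ∧ k ≤ T)) (ω : Ω) :
    noisePath η T ω₀ ω k = η k ω₀ := if_neg hk

variable [∀ k, MeasurableSpace (E k)]

lemma measurable_mixPath_of_apply {_ : MeasurableSpace Ω} {t : ℕ} {f g : Ω → NoisePath E}
    (hf : ∀ k ≤ t, Measurable fun ω => f ω k) (hg : ∀ k, t < k → Measurable fun ω => g ω k) :
    Measurable fun ω => mixPath t (f ω) (g ω) := by
  refine measurable_pi_iff.2 fun k => ?_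
  by_cases hk : k ≤ t
  · simpa only [mixPath_of_le _ _ hk] using hf k hk
  · simpa only [mixPath_of_lt _ _ (not_le.1 hk)] using hg k (not_le.1 hk)

variable [MeasurableSpace Ω] {P : Measure Ω}

lemma measurable_noisePath (hη : ∀ k, 1 ≤ k → k ≤ T → Measurable (η k)) :
    Measurable (noisePath η T ω₀) := by
  refine measurable_pi_iff.2 fun k => ?_
  by_cases hk : 1 ≤ k ∧ k ≤ T
  · simpa only [noisePath_of_le hk.1 hk.2] using hη k hk.1 hk.2
  · simpa only [noisePath_of_not hk] using measurable_const

/-- The past and the future of an independent noise process are independent. -/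
lemma indepFun_mixPath_noisePath (hη : ∀ k, 1 ≤ k → k ≤ T → Measurable (η k))
    (hind : iIndepFun (fun (k : Fin T) ω => η ((k : ℕ) + 1) ω) P) (t : ℕ) :
    IndepFun (fun ω => mixPath t (noisePath η T ω₀ ω) (noisePath η T ω₀ ω₀))
      (fun ω => mixPath t (noisePath η T ω₀ ω₀) (noisePath η T ω₀ ω)) P := by
  let m : Fin T → MeasurableSpace Ω := fun k => MeasurableSpace.comap (η ((k : ℕ) + 1)) inferInstance
  have hm : ∀ k, m k ≤ ‹MeasurableSpace Ω› := fun k =>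
    (hη _ (by omega) (by omega)).comap_le
  have hdisj : Disjoint {k : Fin T | (k : ℕ) + 1 ≤ t} {k : Fin T | t < (k : ℕ) + 1} := by
    rw [Set.disjoint_left]
    intro k (hk : (k : ℕ) + 1 ≤ t) (hk' : t < (k : ℕ) + 1)
    exact absurd hk' (not_lt.2 hk)
  have h := indep_iSup_of_disjoint hm hind.iIndep hdisj
  have hcoord : ∀ (S : Set (Fin T)) (k : ℕ), (∀ j : Fin T, (j : ℕ) + 1 = k → j ∈ S) →
      Measurable[⨆ j ∈ S, m j] fun ω => noisePath η T ω₀ ω k := by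
    intro S k hk
    by_cases hkT : 1 ≤ k ∧ k ≤ T
    · obtain ⟨j, rfl⟩ : ∃ j, k = j + 1 := ⟨k - 1, by omega⟩
      simp only [noisePath_of_le hkT.1 hkT.2]
      rw [measurable_iff_comap_le]
      exact le_iSup₂_of_le (f := fun (j : Fin T) (_ : j ∈ S) => m j) ⟨j, by omega⟩ (hk _ rfl) le_rfl
    · simp only [noisePath_of_not hkT]
      exact measurable_const
  rw [IndepFun_iff_Indep]
  refine indep_of_indep_of_le_left (indep_of_indep_of_le_right h ?_) ?_
  · rw [← measurable_iff_comap_le]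
    refine measurable_mixPath_of_apply (fun _ _ => measurable_const) fun k hk => ?_
    refine hcoord _ k fun j hj => ?_
    change t < (j : ℕ) + 1
    omega
  · rw [← measurable_iff_comap_le]
    refine measurable_mixPath_of_apply (fun k hk => ?_) fun _ _ => measurable_const
    refine hcoord _ k fun j hj => ?_
    change (j : ℕ) + 1 ≤ t
    omega

lemma map_mixPath_noisePath [IsProbabilityMeasure P]
    (hη : ∀ k, 1 ≤ k → k ≤ T → Measurable (η k))
    (hind : iIndepFun (fun (k : Fin T) ω => η ((k : ℕ) + 1) ω) P) (t : ℕ) :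
    ((P.map (noisePath η T ω₀)).prod (P.map (noisePath η T ω₀))).map
      (fun p => mixPath t p.1 p.2) = P.map (noisePath η T ω₀) := by
  have hH : Measurable (noisePath η T ω₀) := measurable_noisePath hη
  set H := noisePath η T ω₀
  let A : Ω → NoisePath E := fun ω => mixPath t (H ω) (H ω₀)
  let B : Ω → NoisePath E := fun ω => mixPath t (H ω₀) (H ω)
  have hA : Measurable A := (measurable_mixPath t).comp (hH.prodMk measurable_const)
  have hB : Measurable B := (measurable_mixPath t).comp (measurable_const.prodMk hH)
  have hAB : ∀ ω ω', mixPath t (A ω) (B ω') = mixPath t (H ω) (H ω') := by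
    intro ω ω'
    funext k
    by_cases hk : k ≤ t <;> simp [mixPath, A, B, hk]
  have hself : ∀ ω, mixPath t (H ω) (H ω) = H ω := by
    intro ω
    funext k
    by_cases hk : k ≤ t <;> simp [mixPath, hk]
  have hmap : P.map (fun ω => (A ω, B ω)) = (P.map A).prod (P.map B) :=
    (indepFun_iff_map_prod_eq_prod_map_map hA.aemeasurable hB.aemeasurable).1
      (indepFun_mixPath_noisePath hη hind t)
  have h1 := Measure.map_map (μ := P) (measurable_mixPath (E := E) t) (hA.prodMk hB)
  rw [hmap, Measure.map_prod_map _ _ hA hB,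
    Measure.map_map (measurable_mixPath t) (hA.prodMap hB)] at h1
  rw [Measure.map_prod_map _ _ hH hH, Measure.map_map (measurable_mixPath t) (hH.prodMap hH)]
  convert! h1 using 2
  · funext p
    exact (hAB p.1 p.2).symm
  · funext ω
    exact ((hAB ω ω).trans (hself ω)).symm

end Noise

variable {T : ℕ} {ι Ω : Type*} {W : ι → ℕ → Type*}
  [∀ j t, MeasurableSpace (W j t)] {i : ι} {X U R E : ℕ → Type*}
  [∀ t, MeasurableSpace (X t)] [∀ t, MeasurableSpace (U t)] [∀ t, MeasurableSpace (R t)]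
  [∀ t, MeasurableSpace (E t)]

/-- The data of a unit whose noise is a function `pr` of another noise. -/
def LocalData.pullback (D : LocalData T X U (W i) R) (pr : ∀ k, E k → W i k)
    (hpr : ∀ k, Measurable (pr k)) : LocalData T X U E R where
  g t x u e := D.g t x u (pr (t + 1) e)
  Θ := D.Θ
  L t x u e := D.L t x u (pr (t + 1) e)
  K := D.K
  measurable_g t ht := (D.measurable_g t ht).comp (measurable_fst.prodMk
    (measurable_snd.fst.prodMk ((hpr _).comp measurable_snd.snd)))
  measurable_Θ := D.measurable_Θ
  measurable_L t ht := (D.measurable_L t ht).comp (measurable_fst.prodMk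
    (measurable_snd.fst.prodMk ((hpr _).comp measurable_snd.snd)))
  measurable_K := D.measurable_K
  L_ne_bot t ht x u _ := D.L_ne_bot t ht x u _
  K_ne_bot := D.K_ne_bot

variable {D : LocalData T X U (W i) R} {w : ∀ j t, Ω → W j t} {S : InfoStructure} {r : ∀ t, R t} {pr : ∀ k, E k → W i k}
  {hpr : ∀ k, Measurable (pr k)} {η : ∀ k, Ω → E k} {ω₀ : Ω}
  [∀ t, Nonempty (X t)]

lemma costToGo_eq_policyCost (hw : ∀ k ω, w i k ω = pr k (η k ω)) {t : ℕ} (htT : t ≤ T) {x : X t}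
    {ξ : ∀ s, Ω → X s} {υ : ∀ s, Ω → U s} {h : ∀ s, NoisePath E → U s}
    (hυ : ∀ s, t ≤ s → s < T → ∀ ω, υ s ω = h s (noisePath η T ω₀ ω))
    (hξ : ∀ s, t ≤ s → s ≤ T → ∀ ω,
      ξ s ω = policyState (D.pullback pr hpr) t x h s (noisePath η T ω₀ ω)) :
    costToGo D w t ξ υ = policyCost (D.pullback pr hpr) t x h ∘ noisePath η T ω₀ := by
  funext ω
  rw [costToGo, Function.comp_apply, policyCost, hξ T htT le_rfl]
  congr 1
  refine Finset.sum_congr rfl fun s hs => ?_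
  obtain ⟨h1, h2⟩ := Finset.mem_Ico.1 hs
  rw [hξ s h1 h2.le, hυ s h1 h2, hw, noisePath_of_le (by omega) h2]
  rfl

variable [MeasurableSpace Ω] {P : Measure Ω}

/-- A feasible policy defines an admissible process. -/
lemma IsPolicy.isAdmissible (hη : ∀ k, 1 ≤ k → k ≤ T → Measurable (η k))
    (hw : ∀ k ω, w i k ω = pr k (η k ω))
    (hinfo : ∀ s, infoField w i S s
      = ⨆ k ∈ Finset.Icc 1 s, MeasurableSpace.comap (η k) inferInstance)
    {t : ℕ} {x : X t} {h : ∀ s, NoisePath E → U s} (hh : IsPolicy t h)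
    (hf : IsFeasible (D.pullback pr hpr) (P.map (noisePath η T ω₀)) r t x h) :
    IsAdmissible D P w S (fun s _ => r s) t x
      (fun s ω => policyState (D.pullback pr hpr) t x h s (noisePath η T ω₀ ω))
      (fun s ω => h s (noisePath η T ω₀ ω)) where
  init ω := policyState_self x h _
  dynamics s hs hsT ω := by
    rw [policyState_succ _ _ _ hs, noisePath_of_le (by omega) hsT, hw]
    rfl
  nonanticipative s hs hsT := by
    have h1 : (fun ω => h s (noisePath η T ω₀ ω))
        = fun ω => h s (mixPath s (noisePath η T ω₀ ω) (noisePath η T ω₀ ω₀)) := by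
      funext ω
      exact hh.congr s hs _ _ fun k hk => (mixPath_of_le _ _ hk).symm
    rw [h1, hinfo]
    refine (hh.measurable s).comp (measurable_mixPath_of_apply (fun k hks => ?_)
      fun _ _ => measurable_const)
    by_cases hk : 1 ≤ k ∧ k ≤ T
    · simp only [noisePath_of_le hk.1 hk.2]
      rw [measurable_iff_comap_le]
      exact le_iSup₂_of_le (f := fun k (_ : k ∈ Finset.Icc 1 s) =>
        MeasurableSpace.comap (η k) inferInstance) k (Finset.mem_Icc.2 ⟨hk.1, hks⟩) le_rfl
    · simp only [noisePath_of_not hk]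
      exact measurable_const
  resource s hs hsT := ae_of_ae_map (measurable_noisePath hη).aemeasurable (hf s hs hsT)

variable [∀ t, MeasurableSingletonClass (R t)]

/-- Every admissible process is given by a feasible policy (Doob–Dynkin). -/
lemma IsAdmissible.exists_isPolicy [∀ t, Nonempty (U t)] [∀ t, StandardBorelSpace (U t)]
    (hη : ∀ k, 1 ≤ k → k ≤ T → Measurable (η k))
    (hw : ∀ k ω, w i k ω = pr k (η k ω))
    (hinfo : ∀ s, infoField w i S s
      = ⨆ k ∈ Finset.Icc 1 s, MeasurableSpace.comap (η k) inferInstance)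
    {t : ℕ} {x : X t} {ξ : ∀ s, Ω → X s} {υ : ∀ s, Ω → U s}
    (ha : IsAdmissible D P w S (fun s _ => r s) t x ξ υ) :
    ∃ h : ∀ s, NoisePath E → U s, IsPolicy t h ∧
      IsFeasible (D.pullback pr hpr) (P.map (noisePath η T ω₀)) r t x h ∧
      (∀ s, t ≤ s → s < T → ∀ ω, υ s ω = h s (noisePath η T ω₀ ω)) ∧
      ∀ s, t ≤ s → s ≤ T → ∀ ω,
        ξ s ω = policyState (D.pullback pr hpr) t x h s (noisePath η T ω₀ ω) := by
  classical
  have hH : Measurable (noisePath η T ω₀) := measurable_noisePath hη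
  set H := noisePath η T ω₀ with hHdef
  have hex : ∀ s, ∃ h : NoisePath E → U s, Measurable h ∧
      (t ≤ s → s < T → ∀ ω, υ s ω = h (mixPath s (H ω) (H ω₀))) := by
    intro s
    by_cases hs : t ≤ s ∧ s < T
    · have hm : Measurable[MeasurableSpace.comap (fun ω => mixPath s (H ω) (H ω₀)) inferInstance]
          (υ s) := by
        refine (ha.nonanticipative s hs.1 hs.2).mono ?_ le_rfl
        rw [hinfo]
        refine iSup₂_le fun k hk => ?_
        obtain ⟨h1, h2⟩ := Finset.mem_Icc.1 hk
        have hηk : η k = (fun e : NoisePath E => e k) ∘ fun ω => mixPath s (H ω) (H ω₀) := by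
          funext ω
          rw [Function.comp_apply, mixPath_of_le _ _ h2, hHdef, noisePath_of_le h1 (by omega)]
        rw [hηk, ← MeasurableSpace.comap_comp]
        exact MeasurableSpace.comap_mono (measurable_pi_apply k).comap_le
      obtain ⟨h, hh, hυ⟩ := hm.exists_eq_measurable_comp
      exact ⟨h, hh, fun _ _ ω => congrFun hυ ω⟩
    · exact ⟨fun _ => Classical.arbitrary _, measurable_const, fun h1 h2 => absurd ⟨h1, h2⟩ hs⟩
  choose h₀ hh₀ hυ₀ using hex
  let h : ∀ s, NoisePath E → U s := fun s e => h₀ s (mixPath s e (H ω₀))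
  have hh : IsPolicy t h :=
    ⟨fun s => (hh₀ s).comp ((measurable_mixPath s).comp measurable_prodMk_right),
      fun s _ e e' hee' => by
        have : mixPath s e (H ω₀) = mixPath s e' (H ω₀) := by
          funext k
          by_cases hk : k ≤ s
          · rw [mixPath_of_le _ _ hk, mixPath_of_le _ _ hk, hee' k hk]
          · rw [mixPath_of_lt _ _ (not_le.1 hk), mixPath_of_lt _ _ (not_le.1 hk)]
        simp only [h, this]⟩
  have hυ : ∀ s, t ≤ s → s < T → ∀ ω, υ s ω = h s (H ω) := hυ₀
  have hξ : ∀ s, t ≤ s → s ≤ T → ∀ ω,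
      ξ s ω = policyState (D.pullback pr hpr) t x h s (H ω) := by
    intro s hs hsT ω
    induction s, hs using Nat.le_induction with
    | base => rw [ha.init, policyState_self]
    | succ s hs ih =>
      rw [ha.dynamics s hs hsT, policyState_succ _ _ _ hs, ih (by omega), hυ s hs hsT, hw, hHdef,
        noisePath_of_le (by omega) hsT]
      rfl
  refine ⟨h, hh, fun s hs hsT => ?_, hυ, hξ⟩
  refine (ae_map_iff hH.aemeasurable (hh.measurableSet_resource r x hs hsT)).2 ?_
  filter_upwards [ha.resource s hs hsT] with ω hω
  rwa [hξ s hs hsT.le, hυ s hs hsT] at hω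

lemma resourceValue_eq_optimalValue [∀ t, Nonempty (U t)] [∀ t, StandardBorelSpace (U t)]
    (hη : ∀ k, 1 ≤ k → k ≤ T → Measurable (η k))
    (hw : ∀ k ω, w i k ω = pr k (η k ω))
    (hinfo : ∀ s, infoField w i S s
      = ⨆ k ∈ Finset.Icc 1 s, MeasurableSpace.comap (η k) inferInstance)
    {t : ℕ} (htT : t ≤ T) (x : X t) :
    resourceValue D P w S (fun s _ => r s) t x
      = optimalValue (D.pullback pr hpr) (P.map (noisePath η T ω₀)) r t x := by
  have hH : Measurable (noisePath η T ω₀) := measurable_noisePath hη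
  refine le_antisymm (le_iInf₂ fun h hh => le_iInf fun hf => ?_)
    (le_iInf₂ fun ξ υ => le_iInf fun ha => ?_)
  · refine (iInf₂_le_of_le _ _ (iInf_le _ (hh.isAdmissible hη hw hinfo hf))).trans_eq ?_
    rw [costToGo_eq_policyCost hw htT (fun _ _ _ _ => rfl) (fun _ _ _ _ => rfl),
      extExpectation_map hH.aemeasurable (hh.measurable_policyCost x htT).aemeasurable]
  · obtain ⟨h, hh, hf, hυ, hξ⟩ := ha.exists_isPolicy (hpr := hpr) (ω₀ := ω₀) hη hw hinfo
    refine (optimalValue_le hh).trans_eq ?_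
    rw [policyValue_of_isFeasible hf, costToGo_eq_policyCost hw htT hυ hξ,
      extExpectation_map hH.aemeasurable (hh.measurable_policyCost x htT).aemeasurable]

/-- The Bellman equation for an information structure generated by a noise process `η` which is
independent over time and determines the noise of unit `i`. -/
theorem bellman_of_generating_noise [IsProbabilityMeasure P] [∀ t, Nonempty (U t)] [∀ t, StandardBorelSpace (U t)]
    (hη : ∀ k, 1 ≤ k → k ≤ T → Measurable (η k))
    (hind : iIndepFun (fun (k : Fin T) ω => η ((k : ℕ) + 1) ω) P)
    (hpr : ∀ k, Measurable (pr k)) (hw : ∀ k ω, w i k ω = pr k (η k ω))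
    (hinfo : ∀ s, infoField w i S s
      = ⨆ k ∈ Finset.Icc 1 s, MeasurableSpace.comap (η k) inferInstance)
    (hexp : ∀ t ≤ T, ∀ (x : X t) (ξ : ∀ s, Ω → X s) (υ : ∀ s, Ω → U s),
      IsAdmissible D P w S (fun s _ => r s) t x ξ υ → HasExtExpectation P (costToGo D w t ξ υ))
    (hbot : ∀ t ≤ T, ∀ x : X t, resourceValue D P w S (fun s _ => r s) t x ≠ ⊥) :
    (∀ x : X T, resourceValue D P w S (fun s _ => r s) T x = D.K x) ∧
    (∀ t < T, ∀ x : X t,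
      resourceValue D P w S (fun s _ => r s) t x =
        ⨅ (u : U t) (_ : D.Θ t x u = r t),
          extExpectation P
            (stageCost D w t (resourceValue D P w S (fun s _ => r s) (t + 1)) x u)) ∧
    (∀ t < T, ∀ (x : X t) (u : U t), D.Θ t x u = r t →
      AEMeasurable (stageCost D w t (resourceValue D P w S (fun s _ => r s) (t + 1)) x u) P ∧
      ((∀ᵐ ω ∂P, stageCost D w t (resourceValue D P w S (fun s _ => r s) (t + 1)) x u ω ≠ ⊤) →
        HasExtExpectation P
          (stageCost D w t (resourceValue D P w S (fun s _ => r s) (t + 1)) x u))) := by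
  obtain ⟨ω₀⟩ : Nonempty Ω := nonempty_of_isProbabilityMeasure P
  have hH : Measurable (noisePath η T ω₀) := measurable_noisePath hη
  let D' := D.pullback pr hpr
  set ν := P.map (noisePath η T ω₀) with hν
  have : IsProbabilityMeasure ν := Measure.isProbabilityMeasure_map hH.aemeasurable
  have hV : ∀ t ≤ T, ∀ x : X t,
      resourceValue D P w S (fun s _ => r s) t x = optimalValue D' ν r t x :=
    fun t ht x => resourceValue_eq_optimalValue hη hw hinfo ht x
  have hD : IsWellPosed D' ν r :=
    { map_mixPath := fun t _ => map_mixPath_noisePath hη hind t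
      hasExtExpectation := fun t ht x h hh hf => by
        rw [hasExtExpectation_map_iff hH.aemeasurable
          (hh.measurable_policyCost x ht).aemeasurable,
          ← costToGo_eq_policyCost hw ht (fun _ _ _ _ => rfl) (fun _ _ _ _ => rfl)]
        exact hexp t ht x _ _ (hh.isAdmissible hη hw hinfo hf)
      optimalValue_ne_bot := fun t ht x => by
        rw [← hV t ht]
        exact hbot t ht x }
  have hstage : ∀ t < T, ∀ (x : X t) (u : U t),
      stageCost D w t (resourceValue D P w S (fun s _ => r s) (t + 1)) x u
        = bellmanCost D' ν r t x u ∘ noisePath η T ω₀ := by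
    intro t ht x u
    funext ω
    rw [stageCost, hV (t + 1) ht, hw, Function.comp_apply, bellmanCost,
      noisePath_of_le (by omega) ht]
    rfl
  have hB : ∀ t (ht : t < T), _ := fun t ht =>
    ((hD.hasCodedPolicies (t := t + 1) ht).bellman hD ht).2
  refine ⟨fun x => ?_, fun t ht x => ?_, fun t ht x u hu => ?_⟩
  · rw [hV T le_rfl, optimalValue_horizon]
    rfl
  · rw [hV t ht.le, (hB t ht).1 x]
    refine iInf_congr fun u => iInf_congr fun hu => ?_
    rw [hstage t ht, hν, extExpectation_map hH.aemeasurable ((hB t ht).2 x u hu).1]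
  · obtain ⟨hm, hE⟩ := (hB t ht).2 x u hu
    rw [hstage t ht]
    refine ⟨hm.comp_measurable hH, fun hfin => ?_⟩
    refine (hasExtExpectation_map_iff hH.aemeasurable hm).1 (hE ?_)
    have hnull : NullMeasurableSet {e | bellmanCost D' ν r t x u e ≠ ⊤}ᶜ ν := by
      have := hm.nullMeasurable (measurableSet_singleton ⊤)
      convert! this using 1
      ext e
      simp
    rw [ae_iff] at hfin ⊢
    rw [show {e | ¬bellmanCost D' ν r t x u e ≠ ⊤} = {e | bellmanCost D' ν r t x u e ≠ ⊤}ᶜ from rfl,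
      hν, Measure.map_apply₀ hH.aemeasurable hnull]
    exact hfin

end Transfer

/-! ### The two information structures -/

theorem proposition4 {T : ℕ} {ι : Type*} [Finite ι] {Ω : Type*} [MeasurableSpace Ω]
    (P : Measure Ω) [IsProbabilityMeasure P]
    {W : ι → ℕ → Type*} [∀ j t, MeasurableSpace (W j t)]
    -- the noises, stagewise independent as a global process
    (w : ∀ j t, Ω → W j t) (hw : ∀ j t, 1 ≤ t → t ≤ T → Measurable (w j t))
    (hindep : iIndepFun (fun (k : Fin T) (ω : Ω) (j : ι) => w j ((k : ℕ) + 1) ω) P)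
    -- the data of the unit `i`
    (i : ι) {X U R : ℕ → Type*}
    [∀ t, MeasurableSpace (X t)] [∀ t, Nonempty (X t)]
    [∀ t, MeasurableSpace (U t)] [∀ t, Nonempty (U t)] [∀ t, StandardBorelSpace (U t)]
    [∀ t, MeasurableSpace (R t)] [∀ t, MeasurableSingletonClass (R t)]
    (D : LocalData T X U (W i) R)
    -- the information structure and the deterministic resource process
    (S : InfoStructure) (r : ∀ t, R t)
    -- expected costs are well defined and the local value functions do not take the value `-∞`
    (hexp : ∀ t ≤ T, ∀ (x : X t) (ξ : ∀ s, Ω → X s) (υ : ∀ s, Ω → U s),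
      IsAdmissible D P w S (fun s _ => r s) t x ξ υ → HasExtExpectation P (costToGo D w t ξ υ))
    (hbot : ∀ t ≤ T, ∀ x : X t, resourceValue D P w S (fun s _ => r s) t x ≠ ⊥) :
    (∀ x : X T, resourceValue D P w S (fun s _ => r s) T x = D.K x) ∧
    (∀ t < T, ∀ x : X t,
      resourceValue D P w S (fun s _ => r s) t x =
        ⨅ (u : U t) (_ : D.Θ t x u = r t),
          extExpectation P
            (stageCost D w t (resourceValue D P w S (fun s _ => r s) (t + 1)) x u)) ∧
    -- the expectations in the recursion are meaningful
    (∀ t < T, ∀ (x : X t) (u : U t), D.Θ t x u = r t →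
      AEMeasurable (stageCost D w t (resourceValue D P w S (fun s _ => r s) (t + 1)) x u) P ∧
      ((∀ᵐ ω ∂P, stageCost D w t (resourceValue D P w S (fun s _ => r s) (t + 1)) x u ω ≠ ⊤) →
        HasExtExpectation P
          (stageCost D w t (resourceValue D P w S (fun s _ => r s) (t + 1)) x u))) := by
  cases S with
  | centralized =>
    -- The information is generated by the global noise, of which the noise of the unit is a
    -- component.
    refine bellman_of_generating_noise (E := fun k => ∀ j, W j k) (η := fun k ω j => w j k ω)
      (pr := fun k e => e i) (fun k h1 hT => measurable_pi_iff.2 fun j => hw j k h1 hT) hindep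
      (fun k => measurable_pi_apply i) (fun _ _ => rfl) (fun s => ?_) hexp hbot
    simp only [infoField, MeasurableSpace.pi, MeasurableSpace.comap_iSup,
      MeasurableSpace.comap_comp]
    rw [iSup_comm]
    refine iSup_congr fun k => ?_
    rw [iSup_comm]
    rfl
  | decentralized =>
    exact bellman_of_generating_noise (E := W i) (η := w i) (pr := fun _ e => e)
      (fun k h1 hT => hw i k h1 hT)
      (hindep.comp (fun _ e => e i) fun _ => measurable_pi_apply i)
      (fun _ => measurable_id) (fun _ _ => rfl) (fun _ => rfl) hexp hbot
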